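/- Let $(X_1,\mathcal F_1,\mu_1)$ and $(X_2,\mathcal F_2,\mu_2)$ be $\sigma$-finite measure spaces and let $(X,\mathcal F,\mu)=(X_1\times X_2,\mathcal F_1\otimes\mathcal F_2,\mu_1\otimes\mu_2)$. For $p,q\in[1,\infty]$ and measurable $f:X\to\mathbb C$ put $$\|f\|_{L^{p,q}}:=\Big\|\,x_2\mapsto\|f(\cdot,x_2)\|_{L^p(\mu_1)}\Big\|_{L^q(\mu_2)}\in[0,\infty].$$ Functions that agree $\mu$-almost everywhere are identified. Let $\mathscr G=L^1\cap L^\infty\cap L^{1,\infty}\cap L^{\infty,1}$ be the space of all (equivalence classes of) measurable $g:X\to\mathbb C$ for which $$\|g\|_{\mathscr G}:=\max\big\{\|g\|_{L^1(\mu)},\ \|g\|_{L^\infty(\mu)},\ \|g\|_{L^{1,\infty}},\ \|g\|_{L^{\infty,1}}\big\}$$ is finite, and let $\mathscr H=L^1+L^\infty+L^{1,\infty}+L^{\infty,1}$ be the space of all (equivalence classes of) measurable $f:X\to\mathbb C$ for which $$\|f\|_{\mathscr H}:=\inf\big\{\|f_1\|_{L^1(\mu)}+\|f_2\|_{L^\infty(\mu)}+\|f_3\|_{L^{1,\infty}}+\|f_4\|_{L^{\infty,1}}\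 :\ f_1,\dots,f_4:X\to\mathbb C\text{ measurable},\ f=f_1+f_2+f_3+f_4\ \mu\text{-a.e.}\big\}$$ is finite. Then the following hold. 1. $\|\cdot\|_{\mathscr H}$ is a norm on $\mathscr H$ (in particular it is definite), and $(\mathscr H,\|\cdot\|_{\mathscr H})$ is a Banach space. 2. If $f:X\to\mathbb C$ is measurable, then $f\in\mathscr H$ if and only if $f\cdot g\in L^1(\mu)$ for all $g\in\mathscr G$. 3. For every $f\in\mathscr H$, $$\frac1{16}\,\|f\|_{\mathscr H}\ \le\ \sup\Big\{\int_X|f\cdot g|\,d\mu\ :\ g\in\mathscr G,\ \|g\|_{\mathscr G}\le1\Big\}\ \le\ 16\,\|f\|_{\mathscr H}.$$ -/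

import Mathlib

open MeasureTheory Filter
open scoped ENNReal

noncomputable section

namespace MixedLebesgue

variable {X₁ X₂ : Type*} [MeasurableSpace X₁] [MeasurableSpace X₂]

/-- The mixed Lebesgue norm `‖f‖_{L^{p,q}} = ‖ x₂ ↦ ‖f(•, x₂)‖_{L^p(μ₁)} ‖_{L^q(μ₂)} ∈ [0,∞]`. -/
def mixedENorm (p q : ℝ≥0∞) (μ₁ : Measure X₁) (μ₂ : Measure X₂) (f : X₁ × X₂ → ℂ) : ℝ≥0∞ :=
  eLpNorm (fun x₂ : X₂ => eLpNorm (fun x₁ : X₁ => f (x₁, x₂)) p μ₁) q μ₂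

/-- The norm of `L¹ ∩ L^∞ ∩ L^{1,∞} ∩ L^{∞,1}`, as an element of `[0,∞]`. -/
def interENorm (μ₁ : Measure X₁) (μ₂ : Measure X₂) (f : X₁ × X₂ → ℂ) : ℝ≥0∞ :=
  max (max (eLpNorm f 1 (μ₁.prod μ₂)) (eLpNorm f ∞ (μ₁.prod μ₂)))
    (max (mixedENorm 1 ∞ μ₁ μ₂ f) (mixedENorm ∞ 1 μ₁ μ₂ f))

/-- The norm of `L¹ + L^∞ + L^{1,∞} + L^{∞,1}`, as an element of `[0,∞]`. The functions
are regarded as equivalence classes, so the decomposition is required to hold almost everywhere. -/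
def sumENorm (μ₁ : Measure X₁) (μ₂ : Measure X₂) (f : X₁ × X₂ → ℂ) : ℝ≥0∞ :=
  sInf {r : ℝ≥0∞ | ∃ f₁ f₂ f₃ f₄ : X₁ × X₂ → ℂ,
    Measurable f₁ ∧ Measurable f₂ ∧ Measurable f₃ ∧ Measurable f₄ ∧
    f =ᵐ[μ₁.prod μ₂] f₁ + f₂ + f₃ + f₄ ∧
    r = eLpNorm f₁ 1 (μ₁.prod μ₂) + eLpNorm f₂ ∞ (μ₁.prod μ₂)
      + mixedENorm 1 ∞ μ₁ μ₂ f₃ + mixedENorm ∞ 1 μ₁ μ₂ f₄}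

section Helpers

variable {μ₁ : Measure X₁} {μ₂ : Measure X₂}

theorem measurable_eLpNorm_section [SigmaFinite μ₁] (p : ℝ≥0∞) {f : X₁ × X₂ → ℂ}
    (hf : Measurable f) : Measurable fun x₂ => eLpNorm (fun x₁ => f (x₁, x₂)) p μ₁ := by
  by_cases h0 : p = 0
  · simp [h0]
  by_cases ht : p = ∞
  · subst ht
    simp only [eLpNorm_exponent_top, eLpNormEssSup]
    refine measurable_of_Ioi fun c => ?_
    have hs : MeasurableSet {z : X₁ × X₂ | c < ‖f z‖ₑ} := measurableSet_lt measurable_const hf.enorm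
    have h := (measurable_measure_prodMk_right (μ := μ₁) hs)
    have key : (fun x₂ => essSup (fun x₁ => ‖f (x₁, x₂)‖ₑ) μ₁) ⁻¹' Set.Ioi c
        = (fun x₂ => μ₁ ((fun x₁ => (x₁, x₂)) ⁻¹' {z : X₁ × X₂ | c < ‖f z‖ₑ})) ⁻¹' {0}ᶜ := by
      ext x₂
      simp only [Set.mem_preimage, Set.mem_Ioi, Set.mem_compl_iff, Set.mem_singleton_iff,
        Set.preimage_ofPred_eq]
      rw [← not_le, not_iff_not]
      constructor
      · intro hle
        have := ENNReal.ae_le_essSup (μ := μ₁) fun x₁ => ‖f (x₁, x₂)‖ₑ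
        have h2 : ∀ᵐ x₁ ∂μ₁, ¬ c < ‖f (x₁, x₂)‖ₑ := by
          filter_upwards [this] with x₁ hx using not_lt.2 (hx.trans hle)
        simpa [ae_iff] using h2
      · intro h0
        refine essSup_le_of_ae_le c ?_
        have h2 : ∀ᵐ x₁ ∂μ₁, ¬ c < ‖f (x₁, x₂)‖ₑ := by simpa [ae_iff] using h0
        filter_upwards [h2] with x₁ hx using not_lt.1 hx
    rw [key]
    exact h (measurableSet_singleton _).compl
  · simp only [eLpNorm_eq_lintegral_rpow_enorm_toReal h0 ht]
    exact ((hf.enorm.pow_const _).lintegral_prod_left').pow_const _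

theorem mixedENorm_congr [SigmaFinite μ₁] [SigmaFinite μ₂] (p q : ℝ≥0∞) {f g : X₁ × X₂ → ℂ}
    (h : f =ᵐ[μ₁.prod μ₂] g) : mixedENorm p q μ₁ μ₂ f = mixedENorm p q μ₁ μ₂ g := by
  have h' : ∀ᵐ z ∂μ₂.prod μ₁, f z.swap = g z.swap :=
    (Measure.measurePreserving_swap (μ := μ₂) (ν := μ₁)).quasiMeasurePreserving.ae h
  have h2 := Measure.ae_ae_of_ae_prod h'
  refine eLpNorm_congr_ae ?_
  filter_upwards [h2] with x₂ hx
  exact eLpNorm_congr_ae hx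

theorem mixedENorm_add_le [SigmaFinite μ₁] {p q : ℝ≥0∞} (hp : 1 ≤ p) (hq : 1 ≤ q)
    {f g : X₁ × X₂ → ℂ} (hf : Measurable f) (hg : Measurable g) :
    mixedENorm p q μ₁ μ₂ (f + g) ≤ mixedENorm p q μ₁ μ₂ f + mixedENorm p q μ₁ μ₂ g := by
  refine le_trans ?_ (eLpNorm_add_le
    (measurable_eLpNorm_section (μ₁ := μ₁) p hf).aestronglyMeasurable
    (measurable_eLpNorm_section (μ₁ := μ₁) p hg).aestronglyMeasurable hq)
  refine eLpNorm_mono_enorm fun x₂ => ?_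
  simp only [enorm_eq_self, Pi.add_apply]
  exact eLpNorm_add_le (hf.comp measurable_prodMk_right).aestronglyMeasurable
    (hg.comp measurable_prodMk_right).aestronglyMeasurable hp

theorem mixedENorm_smul_le (p q : ℝ≥0∞) (c : ℂ) (f : X₁ × X₂ → ℂ) :
    mixedENorm p q μ₁ μ₂ (c • f) ≤ ‖c‖ₑ * mixedENorm p q μ₁ μ₂ f := by
  refine eLpNorm_le_mul_eLpNorm_of_ae_le_mul' (c := ‖c‖₊) (Eventually.of_forall fun x₂ => ?_) q
  simp only [enorm_eq_self]
  exact eLpNorm_const_smul_le (c := c) (f := fun x₁ => f (x₁, x₂))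

@[simp] theorem mixedENorm_zero (p q : ℝ≥0∞) : mixedENorm p q μ₁ μ₂ (0 : X₁ × X₂ → ℂ) = 0 := by
  have : (fun x₂ : X₂ => eLpNorm (fun x₁ : X₁ => (0 : X₁ × X₂ → ℂ) (x₁, x₂)) p μ₁) = 0 := by
    ext x₂
    exact eLpNorm_zero (α := X₁) (ε := ℂ)
  rw [mixedENorm, this, eLpNorm_zero]

theorem interENorm_lt_top_iff {f : X₁ × X₂ → ℂ} : interENorm μ₁ μ₂ f < ∞ ↔
    (eLpNorm f 1 (μ₁.prod μ₂) < ∞ ∧ eLpNorm f ∞ (μ₁.prod μ₂) < ∞) ∧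
      mixedENorm 1 ∞ μ₁ μ₂ f < ∞ ∧ mixedENorm ∞ 1 μ₁ μ₂ f < ∞ := by
  simp only [interENorm, max_lt_iff]

theorem interENorm_congr [SigmaFinite μ₁] [SigmaFinite μ₂] {f g : X₁ × X₂ → ℂ}
    (h : f =ᵐ[μ₁.prod μ₂] g) : interENorm μ₁ μ₂ f = interENorm μ₁ μ₂ g := by
  simp only [interENorm, eLpNorm_congr_ae h, mixedENorm_congr _ _ h]

theorem sumENorm_congr {f g : X₁ × X₂ → ℂ}
    (h : f =ᵐ[μ₁.prod μ₂] g) : sumENorm μ₁ μ₂ f = sumENorm μ₁ μ₂ g := by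
  have key : ∀ k : X₁ × X₂ → ℂ, f =ᵐ[μ₁.prod μ₂] k ↔ g =ᵐ[μ₁.prod μ₂] k :=
    fun k => ⟨fun hk => h.symm.trans hk, fun hk => h.trans hk⟩
  simp only [sumENorm, key]

theorem sumENorm_lt_top_iff {f : X₁ × X₂ → ℂ} : sumENorm μ₁ μ₂ f < ∞ ↔
    ∃ f₁ f₂ f₃ f₄ : X₁ × X₂ → ℂ,
      Measurable f₁ ∧ Measurable f₂ ∧ Measurable f₃ ∧ Measurable f₄ ∧
      f =ᵐ[μ₁.prod μ₂] f₁ + f₂ + f₃ + f₄ ∧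
      eLpNorm f₁ 1 (μ₁.prod μ₂) < ∞ ∧ eLpNorm f₂ ∞ (μ₁.prod μ₂) < ∞ ∧
      mixedENorm 1 ∞ μ₁ μ₂ f₃ < ∞ ∧ mixedENorm ∞ 1 μ₁ μ₂ f₄ < ∞ := by
  rw [sumENorm, sInf_lt_iff]
  constructor
  · rintro ⟨r, ⟨f₁, f₂, f₃, f₄, h₁, h₂, h₃, h₄, h, rfl⟩, hr⟩
    simp only [ENNReal.add_lt_top] at hr
    exact ⟨f₁, f₂, f₃, f₄, h₁, h₂, h₃, h₄, h, hr.1.1.1, hr.1.1.2, hr.1.2, hr.2⟩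
  · rintro ⟨f₁, f₂, f₃, f₄, h₁, h₂, h₃, h₄, h, a, b, c, d⟩
    exact ⟨_, ⟨f₁, f₂, f₃, f₄, h₁, h₂, h₃, h₄, h, rfl⟩, by
      simp only [ENNReal.add_lt_top]; exact ⟨⟨⟨a, b⟩, c⟩, d⟩⟩

end Helpers

variable (μ₁ : Measure X₁) (μ₂ : Measure X₂) [SigmaFinite μ₁] [SigmaFinite μ₂]

/-- The space `𝒢 = L¹ ∩ L^∞ ∩ L^{1,∞} ∩ L^{∞,1}` of equivalence classes of measurable functions. -/
def interSpace : Submodule ℂ ((X₁ × X₂) →ₘ[μ₁.prod μ₂] ℂ) where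
  carrier := {f | interENorm μ₁ μ₂ f < ∞}
  zero_mem' := by
    rw [Set.mem_ofPred_eq, interENorm_congr AEEqFun.coeFn_zero, interENorm_lt_top_iff]
    simp
  add_mem' := by
    intro f g hf hg
    rw [Set.mem_ofPred_eq, interENorm_lt_top_iff] at hf hg
    rw [Set.mem_ofPred_eq, interENorm_congr (AEEqFun.coeFn_add f g), interENorm_lt_top_iff]
    exact ⟨⟨(eLpNorm_add_le f.aestronglyMeasurable g.aestronglyMeasurable le_rfl).trans_lt
        (ENNReal.add_lt_top.2 ⟨hf.1.1, hg.1.1⟩),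
      (eLpNorm_add_le f.aestronglyMeasurable g.aestronglyMeasurable le_top).trans_lt
        (ENNReal.add_lt_top.2 ⟨hf.1.2, hg.1.2⟩)⟩,
      (mixedENorm_add_le le_rfl le_top f.measurable g.measurable).trans_lt
        (ENNReal.add_lt_top.2 ⟨hf.2.1, hg.2.1⟩),
      (mixedENorm_add_le le_top le_rfl f.measurable g.measurable).trans_lt
        (ENNReal.add_lt_top.2 ⟨hf.2.2, hg.2.2⟩)⟩
  smul_mem' := by
    intro c f hf
    rw [Set.mem_ofPred_eq, interENorm_lt_top_iff] at hf
    rw [Set.mem_ofPred_eq, interENorm_congr (AEEqFun.coeFn_smul c f), interENorm_lt_top_iff]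
    exact ⟨⟨eLpNorm_const_smul_le.trans_lt (ENNReal.mul_lt_top enorm_lt_top hf.1.1),
      eLpNorm_const_smul_le.trans_lt (ENNReal.mul_lt_top enorm_lt_top hf.1.2)⟩,
      (mixedENorm_smul_le _ _ c _).trans_lt (ENNReal.mul_lt_top enorm_lt_top hf.2.1),
      (mixedENorm_smul_le _ _ c _).trans_lt (ENNReal.mul_lt_top enorm_lt_top hf.2.2)⟩

instance : Norm (interSpace μ₁ μ₂) := ⟨fun f => (interENorm μ₁ μ₂ f.1).toReal⟩

/-- The space `ℋ = L¹ + L^∞ + L^{1,∞} + L^{∞,1}` of equivalence classes of measurable functions. -/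
def sumSpace : Submodule ℂ ((X₁ × X₂) →ₘ[μ₁.prod μ₂] ℂ) where
  carrier := {f | sumENorm μ₁ μ₂ f < ∞}
  zero_mem' := by
    rw [Set.mem_ofPred_eq, sumENorm_congr AEEqFun.coeFn_zero, sumENorm_lt_top_iff]
    exact ⟨0, 0, 0, 0, measurable_zero, measurable_zero, measurable_zero, measurable_zero,
      by simp, by simp, by simp, by simp, by simp⟩
  add_mem' := by
    intro f g hf hg
    rw [Set.mem_ofPred_eq, sumENorm_lt_top_iff] at hf hg
    rw [Set.mem_ofPred_eq, sumENorm_congr (AEEqFun.coeFn_add f g), sumENorm_lt_top_iff]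
    obtain ⟨f₁, f₂, f₃, f₄, h₁, h₂, h₃, h₄, h, a, b, c, d⟩ := hf
    obtain ⟨g₁, g₂, g₃, g₄, k₁, k₂, k₃, k₄, k, a', b', c', d'⟩ := hg
    refine ⟨f₁ + g₁, f₂ + g₂, f₃ + g₃, f₄ + g₄, h₁.add k₁, h₂.add k₂, h₃.add k₃, h₄.add k₄, ?_,
      (eLpNorm_add_le h₁.aestronglyMeasurable k₁.aestronglyMeasurable le_rfl).trans_lt
        (ENNReal.add_lt_top.2 ⟨a, a'⟩),
      (eLpNorm_add_le h₂.aestronglyMeasurable k₂.aestronglyMeasurable le_top).trans_lt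
        (ENNReal.add_lt_top.2 ⟨b, b'⟩),
      (mixedENorm_add_le le_rfl le_top h₃ k₃).trans_lt (ENNReal.add_lt_top.2 ⟨c, c'⟩),
      (mixedENorm_add_le le_top le_rfl h₄ k₄).trans_lt (ENNReal.add_lt_top.2 ⟨d, d'⟩)⟩
    filter_upwards [h, k] with x hx kx
    simp only [Pi.add_apply] at hx kx ⊢
    rw [hx, kx]
    ring
  smul_mem' := by
    intro r f hf
    rw [Set.mem_ofPred_eq, sumENorm_lt_top_iff] at hf
    rw [Set.mem_ofPred_eq, sumENorm_congr (AEEqFun.coeFn_smul r f), sumENorm_lt_top_iff]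
    obtain ⟨f₁, f₂, f₃, f₄, h₁, h₂, h₃, h₄, h, a, b, c, d⟩ := hf
    refine ⟨r • f₁, r • f₂, r • f₃, r • f₄, h₁.const_smul r, h₂.const_smul r, h₃.const_smul r,
      h₄.const_smul r, ?_, eLpNorm_const_smul_le.trans_lt (ENNReal.mul_lt_top enorm_lt_top a),
      eLpNorm_const_smul_le.trans_lt (ENNReal.mul_lt_top enorm_lt_top b),
      (mixedENorm_smul_le _ _ r _).trans_lt (ENNReal.mul_lt_top enorm_lt_top c),
      (mixedENorm_smul_le _ _ r _).trans_lt (ENNReal.mul_lt_top enorm_lt_top d)⟩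
    filter_upwards [h] with x hx
    simp only [Pi.add_apply, Pi.smul_apply, smul_eq_mul] at hx ⊢
    rw [hx]
    ring

instance : Norm (sumSpace μ₁ μ₂) := ⟨fun f => (sumENorm μ₁ μ₂ f.1).toReal⟩

/-- A complex vector space `E` with a real-valued functional `‖•‖` is a Banach space: the functional
satisfies the norm axioms (including definiteness), and `E` is complete for the induced metric. -/
def IsBanachSpace (E : Type*) [AddCommGroup E] [Module ℂ E] [Norm E] : Prop :=
  ∃ core : NormedSpace.Core ℂ E,
    @CompleteSpace E (NormedAddCommGroup.ofCore core).toMetricSpace.toUniformSpace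

end MixedLebesgue

end

/-! One half is Hölder: pairing `L¹` with `L^∞` and `L^{1,∞}` with `L^{∞,1}` bounds `∫ |f g|` by the
product of the two norms. Pairing with a strictly positive product weight in the unit ball of `𝒢`
then gives definiteness, and shows that a series absolutely convergent in norm converges absolutely
a.e., which yields completeness.

The substance is the converse: if `0 < c < ‖f‖_ℋ`, some `G ≥ 0` in the unit ball of `𝒢` has `∫ |f| G
> c`. Thus the supremum equals `‖f‖_ℋ`, and the factors 16 are slack. Splitting `f` in proportion to
dominating functions (`exists_decomposition`) reduces everything to nonnegative functions. An
equivalent finite measure `ν` makes `|f|` square integrable. The sums of nonnegative `L²(ν)` tuples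
with `∑ N i (h i) ≤ c` form a convex set that misses `|f|`. It is closed: the tuples form a closed
set by Fatou, and positivity gives `‖h‖ ≤ ‖∑ h i‖`, so `isClosed_image_of_norm_le` applies.
Hahn–Banach and Riesz (`exists_separating`) give a density whose rescaling `G` has dual norms at
most 1; by `componentNorm_le_one_of_dual` it lies in the ball of `𝒢`.

If `‖f‖_ℋ = ∞`, a weighted series of such `G` gives one element of `𝒢` whose product with `f` is not
integrable. -/

namespace MixedLebesgue

/-! ### Closed convex sets in Hilbert space -/

section Hilbert
open scoped Topology

variable {E F : Type*} [NormedAddCommGroup E] [InnerProductSpace ℝ E] [CompleteSpace E]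
  [NormedAddCommGroup F] [NormedSpace ℝ F]

/-- A decreasing sequence of nonempty bounded closed convex sets in a Hilbert space has a common
point: the points of minimal norm form a Cauchy sequence. -/
theorem nonempty_iInter_of_antitone_of_convex {K : ℕ → Set E} (hK : Antitone K)
    (hcl : ∀ n, IsClosed (K n)) (hco : ∀ n, Convex ℝ (K n)) (hne : ∀ n, (K n).Nonempty)
    {R : ℝ} (hR : ∀ x ∈ K 0, ‖x‖ ≤ R) : (⋂ n, K n).Nonempty := by
  choose x hx hmin using fun n =>
    exists_norm_eq_iInf_of_complete_convex (hne n) (hcl n).isComplete (hco n) 0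
  -- The obtuse-angle property of the projection of 0 onto `K n`; it turns convergence of the
  -- minimal norms into the Cauchy property.
  have hinner : ∀ n, ∀ y ∈ K n, ‖y - x n‖ ^ 2 ≤ ‖y‖ ^ 2 - ‖x n‖ ^ 2 := by
    intro n y hy
    have h := (norm_eq_iInf_iff_real_inner_le_zero (hco n) (hx n)).1 (hmin n) y hy
    rw [zero_sub, inner_neg_left, inner_sub_right, real_inner_self_eq_norm_sq] at h
    rw [norm_sub_sq_real, real_inner_comm]
    linarith
  have hmono : Monotone fun n => ‖x n‖ ^ 2 := by
    intro n m hnm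
    have := hinner n (x m) (hK hnm (hx m))
    have := sq_nonneg ‖x m - x n‖
    simp only
    linarith
  have hbdd : BddAbove (Set.range fun n => ‖x n‖ ^ 2) := by
    refine ⟨R ^ 2, ?_⟩
    rintro _ ⟨n, rfl⟩
    exact pow_le_pow_left₀ (norm_nonneg _) (hR _ (hK n.zero_le (hx n))) 2
  have hC := (tendsto_atTop_ciSup hmono hbdd).cauchySeq
  have hxC : CauchySeq x := by
    rw [Metric.cauchySeq_iff'] at hC ⊢
    intro ε hε
    obtain ⟨n, hn⟩ := hC (ε ^ 2) (by positivity)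
    refine ⟨n, fun m hm => ?_⟩
    have h1 := hn m hm
    have h2 := hinner n (x m) (hK hm (hx m))
    rw [Real.dist_eq] at h1
    have h3 := (le_abs_self _).trans_lt h1
    rw [dist_eq_norm]
    exact lt_of_pow_lt_pow_left₀ 2 hε.le (h2.trans_lt h3)
  obtain ⟨y, hy⟩ := cauchySeq_tendsto_of_complete hxC
  refine ⟨y, Set.mem_iInter.2 fun n => (hcl n).mem_of_tendsto hy ?_⟩
  filter_upwards [eventually_ge_atTop n] with m hm using hK hm (hx m)

/-- A limit `y` of image points has approximate preimages in `C`. The lower bound on `T` keeps them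
bounded, so the nested sets of preimages share a point, which `T` sends to `y`. The bound holds only
on `C`, so it does not compare differences of points, and a direct Cauchy argument is unavailable.
-/
theorem isClosed_image_of_norm_le {C : Set E} (hcl : IsClosed C) (hco : Convex ℝ C)
    (T : E →L[ℝ] F) (hT : ∀ x ∈ C, ‖x‖ ≤ ‖T x‖) : IsClosed (T '' C) := by
  refine isClosed_of_closure_subset fun y hy => ?_
  have hr : ∀ n : ℕ, (0 : ℝ) < 1 / (n + 1) := fun n => by positivity
  obtain ⟨x, hx⟩ := nonempty_iInter_of_antitone_of_convex
    (K := fun n : ℕ => C ∩ T ⁻¹' Metric.closedBall y (1 / (n + 1)))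
    (fun n m hnm => Set.inter_subset_inter_right _ (Set.preimage_mono
      (Metric.closedBall_subset_closedBall (one_div_le_one_div_of_le (by positivity)
        (by exact_mod_cast Nat.succ_le_succ hnm)))))
    (fun n => hcl.inter (Metric.isClosed_closedBall.preimage T.continuous))
    (fun n => hco.inter ((convex_closedBall y _).linear_preimage T.toLinearMap))
    (fun n => by
      obtain ⟨_, ⟨x, hx, rfl⟩, h⟩ := Metric.mem_closure_iff.1 hy _ (hr n)
      exact ⟨x, hx, by rw [Set.mem_preimage, Metric.mem_closedBall, dist_comm]; exact h.le⟩)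
    (R := ‖y‖ + 1)
    (by
      rintro x ⟨hx, hxy⟩
      rw [Set.mem_preimage, Metric.mem_closedBall, dist_eq_norm] at hxy
      have := norm_le_insert' (T x) y
      norm_num at hxy
      linarith [hT x hx])
  rw [Set.mem_iInter] at hx
  refine ⟨x, (hx 0).1, ?_⟩
  refine eq_of_dist_eq_zero (le_antisymm ?_ dist_nonneg)
  exact ge_of_tendsto' tendsto_one_div_add_atTop_nhds_zero_nat fun n => (hx n).2

end Hilbert

/-! ### Function norms with the Fatou property and their sum -/

section FunctionNorm

variable {X : Type*} [MeasurableSpace X]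

/-- Extended function norms on nonnegative measurable functions that are monotone, subadditive,
homogeneous and satisfy Fatou's lemma. -/
structure IsFatouNorm (μ : Measure X) (N : (X → ℝ≥0∞) → ℝ≥0∞) : Prop where
  mono : ∀ {u v : X → ℝ≥0∞}, u ≤ᵐ[μ] v → N u ≤ N v
  add_le : ∀ {u v : X → ℝ≥0∞}, Measurable u → Measurable v →
    N (fun x => u x + v x) ≤ N u + N v
  const_mul : ∀ (c : ℝ≥0∞) {u : X → ℝ≥0∞}, Measurable u → N (fun x => c * u x) = c * N u
  liminf_le : ∀ {u : ℕ → X → ℝ≥0∞}, (∀ n, Measurable (u n)) →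
    N (fun x => liminf (fun n => u n x) atTop) ≤ liminf (fun n => N (u n)) atTop

namespace IsFatouNorm

variable {μ : Measure X} {N : (X → ℝ≥0∞) → ℝ≥0∞}

theorem zero (h : IsFatouNorm μ N) : N (fun _ => 0) = 0 := by
  simpa using h.const_mul 0 (u := fun _ => 0) measurable_const

theorem tsum_le (h : IsFatouNorm μ N) {u : ℕ → X → ℝ≥0∞} (hu : ∀ n, Measurable (u n)) :
    N (fun x => ∑' n, u n x) ≤ ∑' n, N (u n) := by
  have hsum : ∀ n, N (fun x => ∑ k ∈ Finset.range n, u k x)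
      ≤ ∑ k ∈ Finset.range n, N (u k) := by
    intro n
    induction n with
    | zero => simp [h.zero]
    | succ n ih =>
      simp only [Finset.sum_range_succ]
      exact (h.add_le (Finset.measurable_fun_sum _ fun k _ => hu k) (hu n)).trans
        (add_le_add_left ih _)
  have hlim : (fun x => ∑' n, u n x)
      = fun x => liminf (fun n => ∑ k ∈ Finset.range n, u k x) atTop :=
    funext fun x => (ENNReal.tendsto_nat_tsum fun n => u n x).liminf_eq.symm
  rw [hlim]
  refine (h.liminf_le fun n => Finset.measurable_fun_sum _ fun k _ => hu k).trans ?_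
  rw [← (ENNReal.tendsto_nat_tsum fun n => N (u n)).liminf_eq]
  exact liminf_le_liminf (Eventually.of_forall hsum)

end IsFatouNorm

variable {ι : Type*} [Fintype ι] {μ : Measure X} {N : ι → (X → ℝ≥0∞) → ℝ≥0∞}

/-- The infimum of `∑ i, N i (v i)` over all measurable `v` with `u ≤ ∑ i, v i` a.e. -/
noncomputable def sumNorm (μ : Measure X) (N : ι → (X → ℝ≥0∞) → ℝ≥0∞) (u : X → ℝ≥0∞) : ℝ≥0∞ :=
  ⨅ v : {v : ι → X → ℝ≥0∞ // (∀ i, Measurable (v i)) ∧ u ≤ᵐ[μ] fun x => ∑ i, v i x},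
    ∑ i, N i (v.1 i)

theorem sumNorm_le {u : X → ℝ≥0∞} {v : ι → X → ℝ≥0∞} (hv : ∀ i, Measurable (v i))
    (h : u ≤ᵐ[μ] fun x => ∑ i, v i x) : sumNorm μ N u ≤ ∑ i, N i (v i) :=
  iInf_le_of_le ⟨v, hv, h⟩ le_rfl

theorem exists_of_sumNorm_lt {u : X → ℝ≥0∞} {c : ℝ≥0∞} (h : sumNorm μ N u < c) :
    ∃ v : ι → X → ℝ≥0∞, (∀ i, Measurable (v i)) ∧ (u ≤ᵐ[μ] fun x => ∑ i, v i x) ∧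
      ∑ i, N i (v i) < c := by
  obtain ⟨⟨v, hv, huv⟩, h⟩ := iInf_lt_iff.1 h
  exact ⟨v, hv, huv, h⟩

theorem sumNorm_mono {u v : X → ℝ≥0∞} (h : u ≤ᵐ[μ] v) : sumNorm μ N u ≤ sumNorm μ N v :=
  le_iInf fun w => sumNorm_le w.2.1 (h.trans w.2.2)

/-- Near-optimal dominating tuples, with errors summing to less than `ε`, are added up term by term;
the Fatou property makes each `N i` countably subadditive on them. -/
theorem sumNorm_tsum_le (hN : ∀ i, IsFatouNorm μ (N i)) (u : ℕ → X → ℝ≥0∞) :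
    sumNorm μ N (fun x => ∑' n, u n x) ≤ ∑' n, sumNorm μ N (u n) := by
  refine ENNReal.le_of_forall_pos_le_add fun ε hε hfin => ?_
  obtain ⟨δ, hδ, hδsum⟩ := ENNReal.exists_pos_sum_of_countable (ENNReal.coe_ne_zero.2 hε.ne') ℕ
  have hlt : ∀ n, sumNorm μ N (u n) < sumNorm μ N (u n) + δ n := fun n =>
    ENNReal.lt_add_right ((ENNReal.le_tsum n).trans_lt hfin).ne (by exact_mod_cast (hδ n).ne')
  choose v hv huv hvlt using fun n => exists_of_sumNorm_lt (hlt n)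
  calc sumNorm μ N (fun x => ∑' n, u n x)
      ≤ ∑ i, N i (fun x => ∑' n, v n i x) := by
        refine sumNorm_le (fun i => Measurable.tsum fun n => hv n i) ?_
        filter_upwards [ae_all_iff.2 huv] with x hx
        refine (ENNReal.tsum_le_tsum hx).trans_eq ?_
        exact Summable.tsum_finsetSum fun i _ => ENNReal.summable
    _ ≤ ∑ i, ∑' n, N i (v n i) :=
        Finset.sum_le_sum fun i _ => (hN i).tsum_le fun n => hv n i
    _ = ∑' n, ∑ i, N i (v n i) := (Summable.tsum_finsetSum fun i _ => ENNReal.summable).symm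
    _ ≤ ∑' n, (sumNorm μ N (u n) + δ n) := ENNReal.tsum_le_tsum fun n => (hvlt n).le
    _ ≤ _ := by
        rw [ENNReal.tsum_add]
        gcongr

theorem sumNorm_add_le (hN : ∀ i, IsFatouNorm μ (N i)) (u v : X → ℝ≥0∞) :
    sumNorm μ N (fun x => u x + v x) ≤ sumNorm μ N u + sumNorm μ N v := by
  conv_rhs => rw [sumNorm, sumNorm, ENNReal.iInf_add]
  refine le_iInf fun v' => ?_
  rw [ENNReal.add_iInf]
  refine le_iInf fun w => ?_
  refine (sumNorm_le (v := fun i x => v'.1 i x + w.1 i x)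
    (fun i => (v'.2.1 i).add (w.2.1 i)) ?_).trans ?_
  · filter_upwards [v'.2.2, w.2.2] with x hx hx'
    rw [Finset.sum_add_distrib]
    exact add_le_add hx hx'
  · rw [← Finset.sum_add_distrib]
    exact Finset.sum_le_sum fun i _ => (hN i).add_le (v'.2.1 i) (w.2.1 i)

theorem sumNorm_const_mul_le (hN : ∀ i, IsFatouNorm μ (N i)) {c : ℝ≥0∞} (hc : c ≠ 0)
    (hc' : c ≠ ∞) (u : X → ℝ≥0∞) :
    sumNorm μ N (fun x => c * u x) ≤ c * sumNorm μ N u := by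
  unfold sumNorm
  rw [ENNReal.mul_iInf_of_ne hc hc']
  refine le_iInf fun v => ?_
  refine (sumNorm_le (v := fun i x => c * v.1 i x) (fun i => (v.2.1 i).const_mul c) ?_).trans_eq ?_
  · filter_upwards [v.2.2] with x hx
    rw [← Finset.mul_sum]
    gcongr
  · rw [Finset.mul_sum]
    exact Finset.sum_congr rfl fun i _ => (hN i).const_mul c (v.2.1 i)

theorem sumNorm_const_mul (hN : ∀ i, IsFatouNorm μ (N i)) {c : ℝ≥0∞} (hc : c ≠ ∞)
    (u : X → ℝ≥0∞) : sumNorm μ N (fun x => c * u x) = c * sumNorm μ N u := by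
  rcases eq_or_ne c 0 with rfl | h0
  · refine le_antisymm ((sumNorm_le (v := fun _ _ => 0) (fun _ => measurable_const) ?_).trans ?_)
      (by simp)
    · exact Eventually.of_forall fun x => by simp
    · simp [(hN _).zero]
  refine le_antisymm (sumNorm_const_mul_le hN h0 hc u) ?_
  -- The reverse inequality is the same bound for the factor `c⁻¹`.
  have h := sumNorm_const_mul_le hN (ENNReal.inv_ne_zero.2 hc) (ENNReal.inv_ne_top.2 h0)
    (fun x => c * u x)
  simp_rw [← mul_assoc, ENNReal.inv_mul_cancel h0 hc, one_mul] at h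
  calc c * sumNorm μ N u ≤ c * (c⁻¹ * sumNorm μ N fun x => c * u x) := by gcongr
    _ = _ := by rw [← mul_assoc, ENNReal.mul_inv_cancel h0 hc, one_mul]

end FunctionNorm

/-! ### Separation in `L²` and the dual description of the sum norm -/

section Bipolar

variable {X : Type*} [MeasurableSpace X] {ι : Type*} [Fintype ι]

theorem finsetSum_liminf_le (a : ι → ℕ → ℝ≥0∞) :
    ∑ i, liminf (fun n => a i n) atTop ≤ liminf (fun n => ∑ i, a i n) atTop := by
  let _ : MeasurableSpace ι := ⊤
  -- Fatou's lemma for counting measure on `ι`.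
  have h := lintegral_liminf_le (u := atTop) (μ := (Measure.count : Measure ι)) (f := fun n i => a i n)
    fun n => measurable_from_top
  simpa [lintegral_fintype] using h

theorem norm_le_abs_sum_of_nonneg {v : EuclideanSpace ℝ ι} (hv : ∀ i, 0 ≤ v i) :
    ‖v‖ ≤ |∑ i, v i| := by
  rw [EuclideanSpace.norm_eq, abs_of_nonneg (Finset.sum_nonneg fun i _ => hv i)]
  refine Real.sqrt_le_iff.2 ⟨Finset.sum_nonneg fun i _ => hv i, ?_⟩
  simp only [Real.norm_eq_abs, sq_abs]
  exact Finset.sum_sq_le_sq_sum_of_nonneg fun i _ => hv i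

variable (ν : Measure X) (N : ι → (X → ℝ≥0∞) → ℝ≥0∞) (c : ℝ≥0∞)

/-- The square-integrable nonnegative tuples `h` with `∑ i, N i (h i) ≤ c`. -/
def nonnegBall : Set (Lp (EuclideanSpace ℝ ι) 2 ν) :=
  {h | (∀ᵐ x ∂ν, ∀ i, 0 ≤ h x i) ∧ ∑ i, N i (fun x => ENNReal.ofReal (h x i)) ≤ c}

/-- The map sending a tuple of square-integrable functions to its sum. -/
noncomputable def sumLp : Lp (EuclideanSpace ℝ ι) 2 ν →L[ℝ] Lp ℝ 2 ν :=
  ContinuousLinearMap.compLpL 2 ν (∑ i, EuclideanSpace.proj i)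

variable {ν N c}

theorem coeFn_sumLp (h : Lp (EuclideanSpace ℝ ι) 2 ν) :
    sumLp ν h =ᵐ[ν] fun x => ∑ i, h x i := by
  refine (ContinuousLinearMap.coeFn_compLpL _ h).trans (Eventually.of_forall fun x => ?_)
  simp

theorem measurable_ofReal_coord (h : Lp (EuclideanSpace ℝ ι) 2 ν) (i : ι) :
    Measurable fun x => ENNReal.ofReal (h x i) := by
  have := (Lp.stronglyMeasurable h).measurable
  fun_prop

/-- Nonnegative coordinates cannot cancel, and pointwise the `ℓ²` norm is at most the `ℓ¹` norm. -/
theorem norm_le_norm_sumLp {h : Lp (EuclideanSpace ℝ ι) 2 ν} (hh : h ∈ nonnegBall ν N c) :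
    ‖h‖ ≤ ‖sumLp ν h‖ := by
  refine Lp.norm_le_norm_of_ae_le ?_
  filter_upwards [hh.1, coeFn_sumLp h] with x hx hx'
  rw [hx', Real.norm_eq_abs]
  exact norm_le_abs_sum_of_nonneg hx

theorem convex_nonnegBall (hN : ∀ i, IsFatouNorm ν (N i)) : Convex ℝ (nonnegBall ν N c) := by
  intro h hh k hk a b ha hb hab
  have hae : ∀ᵐ x ∂ν, (a • h + b • k : Lp (EuclideanSpace ℝ ι) 2 ν) x = a • h x + b • k x := by
    filter_upwards [Lp.coeFn_add (a • h) (b • k), Lp.coeFn_smul a h, Lp.coeFn_smul b k]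
      with x h1 h2 h3
    rw [h1, Pi.add_apply, h2, h3, Pi.smul_apply, Pi.smul_apply]
  refine ⟨?_, ?_⟩
  · filter_upwards [hae, hh.1, hk.1] with x hx h1 h2 i
    rw [hx]
    simpa using add_nonneg (mul_nonneg ha (h1 i)) (mul_nonneg hb (h2 i))
  · calc ∑ i, N i (fun x => ENNReal.ofReal
            ((a • h + b • k : Lp (EuclideanSpace ℝ ι) 2 ν) x i))
        ≤ ∑ i, (ENNReal.ofReal a * N i (fun x => ENNReal.ofReal (h x i))
            + ENNReal.ofReal b * N i (fun x => ENNReal.ofReal (k x i))) := by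
          refine Finset.sum_le_sum fun i _ => ?_
          rw [← (hN i).const_mul _ (measurable_ofReal_coord h i),
            ← (hN i).const_mul _ (measurable_ofReal_coord k i)]
          refine le_trans ((hN i).mono ?_) ((hN i).add_le
            ((measurable_ofReal_coord h i).const_mul _) ((measurable_ofReal_coord k i).const_mul _))
          filter_upwards [hae] with x hx
          rw [hx]
          simp only [PiLp.add_apply, PiLp.smul_apply, smul_eq_mul]
          rw [← ENNReal.ofReal_mul ha, ← ENNReal.ofReal_mul hb]
          exact ENNReal.ofReal_add_le
      _ ≤ ENNReal.ofReal a * c + ENNReal.ofReal b * c := by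
          rw [Finset.sum_add_distrib, ← Finset.mul_sum, ← Finset.mul_sum]
          gcongr
          exacts [hh.2, hk.2]
      _ = c := by
          rw [← add_mul, ← ENNReal.ofReal_add ha hb, hab, ENNReal.ofReal_one, one_mul]

/-- An `L²` limit is an a.e. limit along a subsequence, and the Fatou property passes the bound to
the limit. -/
theorem isClosed_nonnegBall (hN : ∀ i, IsFatouNorm ν (N i)) : IsClosed (nonnegBall ν N c) := by
  refine IsSeqClosed.isClosed fun h k hh hk => ?_
  obtain ⟨φ, -, hφ⟩ := (tendstoInMeasure_of_tendsto_Lp hk).exists_seq_tendsto_ae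
  have hcoord : ∀ᵐ x ∂ν, ∀ i, Tendsto (fun n => h (φ n) x i) atTop (nhds (k x i)) := by
    filter_upwards [hφ] with x hx i
    exact ((EuclideanSpace.proj (𝕜 := ℝ) i).continuous.tendsto (k x)).comp hx
  refine ⟨?_, ?_⟩
  · filter_upwards [hcoord, ae_all_iff.2 fun n => (hh n).1] with x hx hx' i
    exact ge_of_tendsto' (hx i) fun n => hx' (φ n) i
  · calc ∑ i, N i (fun x => ENNReal.ofReal (k x i))
        ≤ ∑ i, liminf (fun n => N i (fun x => ENNReal.ofReal (h (φ n) x i))) atTop := by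
          refine Finset.sum_le_sum fun i _ => ?_
          refine le_trans ((hN i).mono ?_)
            ((hN i).liminf_le fun n => measurable_ofReal_coord (h (φ n)) i)
          filter_upwards [hcoord] with x hx
          exact ((ENNReal.continuous_ofReal.tendsto _).comp (hx i)).liminf_eq.ge
      _ ≤ liminf (fun n => ∑ i, N i (fun x => ENNReal.ofReal (h (φ n) x i))) atTop :=
          finsetSum_liminf_le _
      _ ≤ liminf (fun _ : ℕ => c) atTop :=
          liminf_le_liminf (Eventually.of_forall fun n => (hh (φ n)).2)
      _ = c := liminf_const c

theorem zero_mem_nonnegBall (hN : ∀ i, IsFatouNorm ν (N i)) :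
    (0 : Lp (EuclideanSpace ℝ ι) 2 ν) ∈ nonnegBall ν N c := by
  have h0 := Lp.coeFn_zero (EuclideanSpace ℝ ι) 2 ν
  refine ⟨?_, ?_⟩
  · filter_upwards [h0] with x hx i
    rw [hx]; rfl
  · refine le_trans (Finset.sum_le_sum fun i _ => (hN i).mono (v := fun _ => 0) ?_) ?_
    · filter_upwards [h0] with x hx
      rw [hx]; simp
    · simp [(hN _).zero]

/-- Hahn–Banach separation of a square-integrable function from the ball of radius `c`. -/
theorem exists_separating (hN : ∀ i, IsFatouNorm ν (N i)) {f : X → ℝ} (hf : MemLp f 2 ν)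
    (hc : c < sumNorm ν N fun x => ENNReal.ofReal (f x)) (hf0 : 0 ≤ f) :
    ∃ (g : X → ℝ) (a : ℝ), Measurable g ∧ 0 ≤ g ∧ 0 ≤ a ∧
      Integrable (fun x => f x * g x) ν ∧
      (∀ i (k : X → ℝ), MemLp k 2 ν → 0 ≤ k → Measurable k →
        N i (fun x => ENNReal.ofReal (k x)) ≤ c →
        Integrable (fun x => k x * g x) ν ∧ ∫ x, k x * g x ∂ν ≤ a) ∧
      a < ∫ x, f x * g x ∂ν := by
  classical
  -- A tuple in the ball with sum `f` would compete in the infimum and force `sumNorm ≤ c`.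
  have hnot : hf.toLp f ∉ sumLp ν '' nonnegBall ν N c := by
    rintro ⟨h, hh, hhf⟩
    refine hc.not_ge ((sumNorm_le (measurable_ofReal_coord h) ?_).trans hh.2)
    filter_upwards [hh.1, coeFn_sumLp h, hf.coeFn_toLp] with x h0 h1 h2
    rw [hhf, h2] at h1
    rw [h1, ENNReal.ofReal_sum_of_nonneg fun i _ => h0 i]
  obtain ⟨φ, a, hφ, hφf⟩ := geometric_hahn_banach_closed_point
    ((convex_nonnegBall hN).linear_image (sumLp ν).toLinearMap)
    (isClosed_image_of_norm_le (isClosed_nonnegBall hN) (convex_nonnegBall hN) (sumLp ν)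
      fun x hx => norm_le_norm_sumLp hx) hnot
  set γ : Lp ℝ 2 ν := (InnerProductSpace.toDual ℝ (Lp ℝ 2 ν)).symm φ with hγ
  have hφγ : ∀ (k : X → ℝ) (hk : MemLp k 2 ν), φ (hk.toLp k) = ∫ x, k x * γ x ∂ν := by
    intro k hk
    rw [← InnerProductSpace.toDual_symm_apply, L2.inner_def]
    refine integral_congr_ae ?_
    filter_upwards [hk.coeFn_toLp] with x hx
    rw [hx]; simp [γ]
  have hγm : Measurable γ := (Lp.stronglyMeasurable γ).measurable
  have hγL : MemLp γ 2 ν := Lp.memLp γ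
  have hgL : MemLp (fun x => max (γ x) 0) 2 ν := hγL.pos_part
  have hint : ∀ k : X → ℝ, MemLp k 2 ν → Integrable (fun x => k x * max (γ x) 0) ν :=
    fun k hk => hk.integrable_mul hgL
  have ha : 0 ≤ a := by
    have := hφ 0 ⟨0, zero_mem_nonnegBall hN, map_zero _⟩
    rw [map_zero] at this
    exact this.le
  refine ⟨fun x => max (γ x) 0, a, hγm.max measurable_const, fun x => le_max_right _ _, ha,
    hint f hf, fun i k hk hk0 hkm hNk => ⟨hint k hk, ?_⟩, ?_⟩
  -- Restricting `k` to `{γ > 0}` stays in the ball and turns `∫ k' γ` into `∫ k γ⁺`. Placed in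
  -- coordinate `i` with zeros elsewhere, `k'` is an admissible tuple.
  · set k' : X → ℝ := {x | 0 < γ x}.indicator k with hk'
    have hk'0 : 0 ≤ k' := fun x => Set.indicator_nonneg (fun x _ => hk0 x) x
    have hs : MeasurableSet {x | 0 < γ x} := measurableSet_lt measurable_const hγm
    have hk'L : MemLp k' 2 ν := hk.indicator hs
    have hKL : MemLp (fun x => EuclideanSpace.single i (k' x)) 2 ν := by
      refine hk'L.of_le ?_ (Eventually.of_forall fun x => ?_)
      · exact ((PiLp.continuous_toLp 2 _).comp (continuous_single i)).comp_aestronglyMeasurable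
          hk'L.1
      · simp
    have hmem : hKL.toLp _ ∈ nonnegBall ν N c := by
      refine ⟨?_, ?_⟩
      · filter_upwards [hKL.coeFn_toLp] with x hx j
        rw [hx, PiLp.single_apply]
        split_ifs
        exacts [hk'0 x, le_rfl]
      · rw [Finset.sum_eq_single i]
        · refine le_trans ((hN i).mono ?_) hNk
          filter_upwards [hKL.coeFn_toLp] with x hx
          rw [hx, PiLp.single_apply, if_pos rfl]
          exact ENNReal.ofReal_le_ofReal (Set.indicator_le_self' (fun x _ => hk0 x) x)
        · refine fun j _ hj => le_antisymm (le_trans ((hN j).mono (v := fun _ => 0) ?_)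
            (hN j).zero.le) zero_le
          filter_upwards [hKL.coeFn_toLp] with x hx
          rw [hx, PiLp.single_apply, if_neg hj, ENNReal.ofReal_zero]
        · simp
    have hsum : sumLp ν (hKL.toLp _) = hk'L.toLp k' := by
      refine Lp.ext ?_
      filter_upwards [coeFn_sumLp (hKL.toLp _), hKL.coeFn_toLp, hk'L.coeFn_toLp] with x h1 h2 h3
      rw [h1, h2, h3]
      simp [PiLp.single_apply]
    have := hφ _ ⟨_, hmem, hsum⟩
    rw [hφγ] at this
    refine le_of_eq_of_le (integral_congr_ae (Eventually.of_forall fun x => ?_)) this.le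
    by_cases hx : 0 < γ x
    · simp [hk', hx, hx.le]
    · simp [hk', hx, not_lt.1 hx]
  · rw [hφγ] at hφf
    refine hφf.trans_le (integral_mono (hf.integrable_mul hγL) (hint f hf) fun x => ?_)
    exact mul_le_mul_of_nonneg_left (le_max_left _ _) (hf0 x)

theorem IsFatouNorm.of_ae_eq {μ ν : Measure X} {N : (X → ℝ≥0∞) → ℝ≥0∞} (h : ae μ = ae ν)
    (hN : IsFatouNorm μ N) : IsFatouNorm ν N where
  mono huv := hN.mono (by rwa [EventuallyLE, h])
  add_le := hN.add_le
  const_mul := hN.const_mul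
  liminf_le := hN.liminf_le

theorem sumNorm_congr_measure {μ ν : Measure X} (h : ae μ = ae ν) (u : X → ℝ≥0∞) :
    sumNorm μ N u = sumNorm ν N u :=
  le_antisymm (le_iInf fun v => sumNorm_le v.2.1 (by rw [EventuallyLE, h]; exact v.2.2))
    (le_iInf fun v => sumNorm_le v.2.1 (by rw [EventuallyLE, ← h]; exact v.2.2))

/-- Integration against a measurable function is determined by bounded test functions. -/
theorem lintegral_mul_le_of_min {μ : Measure X} {k G : X → ℝ≥0∞} (hk : Measurable k)
    (hG : Measurable G) {a : ℝ≥0∞} (h : ∀ n : ℕ, ∫⁻ x, min (k x) n * G x ∂μ ≤ a) :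
    ∫⁻ x, k x * G x ∂μ ≤ a := by
  have hsup : ∀ x, k x * G x = ⨆ n : ℕ, min (k x) n * G x := by
    intro x
    rw [← ENNReal.iSup_mul, ← inf_iSup_eq, ENNReal.iSup_natCast, inf_top_eq]
  simp_rw [hsup]
  rw [lintegral_iSup (f := fun (n : ℕ) x => min (k x) n * G x)
    (fun n => (hk.min measurable_const).mul hG)]
  · exact iSup_le h
  · intro n m hnm x
    dsimp only
    gcongr

/-- If `c < sumNorm μ N u`, some `G` in the unit ball of the dual norm satisfies `c < ∫ u G`. -/
theorem exists_dual_of_lt_sumNorm {μ : Measure X} [SigmaFinite μ] (hN : ∀ i, IsFatouNorm μ (N i))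
    {u : X → ℝ} (hu : Measurable u) (hu0 : 0 ≤ u) {c : ℝ≥0∞} (hc0 : c ≠ 0)
    (hc : c < sumNorm μ N fun x => ENNReal.ofReal (u x)) :
    ∃ G : X → ℝ≥0∞, Measurable G ∧
      (∀ i (k : X → ℝ≥0∞), Measurable k → N i k ≤ 1 → ∫⁻ x, k x * G x ∂μ ≤ 1) ∧
      c < ∫⁻ x, ENNReal.ofReal (u x) * G x ∂μ := by
  obtain ⟨w₀, hw₀, hw₀m, hw₀i⟩ := exists_pos_lintegral_lt_of_sigmaFinite μ one_ne_zero
  -- The denominator gives both `w ≤ w₀` and `u² w ≤ w₀`, so `ν` is finite and `u ∈ L²(ν)`; since `w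
  -- > 0`, the null sets are those of `μ`, and `sumNorm` sees only null sets.
  set w : X → ℝ≥0∞ := fun x => w₀ x / (1 + ENNReal.ofReal (u x) ^ 2) with hw
  have hden : ∀ x, 1 + ENNReal.ofReal (u x) ^ 2 ≠ ∞ := fun x =>
    ENNReal.add_ne_top.2 ⟨ENNReal.one_ne_top, ENNReal.pow_ne_top ENNReal.ofReal_ne_top⟩
  have hwm : Measurable w := by fun_prop
  have hwle : ∀ x, w x ≤ w₀ x := fun x => ENNReal.div_le_of_le_mul
    (le_mul_of_one_le_right zero_le le_self_add)
  have hw0 : ∀ x, w x ≠ 0 := fun x =>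
    (ENNReal.div_pos (by exact_mod_cast (hw₀ x).ne') (hden x)).ne'
  have hwi : ∫⁻ x, w x ∂μ < ∞ :=
    (lintegral_mono hwle).trans_lt (hw₀i.trans ENNReal.one_lt_top)
  set ν := μ.withDensity w with hν
  have : IsFiniteMeasure ν := isFiniteMeasure_withDensity hwi.ne
  have hae : ae μ = ae ν := le_antisymm
    (withDensity_absolutelyContinuous' hwm.aemeasurable (Eventually.of_forall hw0)).ae_le
    (withDensity_absolutelyContinuous μ w).ae_le
  have huL : MemLp u 2 ν := by
    refine (memLp_two_iff_integrable_sq hu.aestronglyMeasurable).2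
      ⟨(hu.pow_const 2).aestronglyMeasurable, ?_⟩
    rw [HasFiniteIntegral, hν, lintegral_withDensity_eq_lintegral_mul _ hwm
      (hu.pow_const 2).enorm]
    refine (lintegral_mono fun x => ?_).trans_lt (hw₀i.trans ENNReal.one_lt_top)
    have hx : ‖u x ^ 2‖ₑ = ENNReal.ofReal (u x) ^ 2 := by
      rw [Real.enorm_eq_ofReal (sq_nonneg _), ENNReal.ofReal_pow (hu0 x)]
    rw [Pi.mul_apply, hx, hw]
    dsimp only
    rw [ENNReal.mul_comm_div, ← mul_div_assoc]
    refine ENNReal.div_le_of_le_mul ?_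
    gcongr
    exact le_add_self
  obtain ⟨g, a, hgm, hg0, ha0, hfgi, hga, haf⟩ := exists_separating
    (fun i => (hN i).of_ae_eq hae) huL (hc.trans_eq (sumNorm_congr_measure hae _)) hu0
  have hctop : c ≠ ∞ := (hc.trans_le le_top).ne
  set H : X → ℝ≥0∞ := fun x => ENNReal.ofReal (g x) * w x with hH
  have hHm : Measurable H := by fun_prop
  have hconv : ∀ k : X → ℝ, 0 ≤ k → Measurable k → Integrable (fun x => k x * g x) ν →
      ∫⁻ x, ENNReal.ofReal (k x) * H x ∂μ = ENNReal.ofReal (∫ x, k x * g x ∂ν) := by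
    intro k hk0 hk hi
    rw [ofReal_integral_eq_lintegral_ofReal hi
      (Eventually.of_forall fun x => mul_nonneg (hk0 x) (hg0 x)), hν,
      lintegral_withDensity_eq_lintegral_mul _ hwm (by fun_prop)]
    refine lintegral_congr fun x => ?_
    rw [Pi.mul_apply, ENNReal.ofReal_mul (hk0 x), hH]
    ring
  -- Choosing `b` strictly above `a` makes it nonzero even when `a = 0`, so that dividing by it is
  -- possible.
  obtain ⟨b, hab, hb⟩ := exists_between
    (ENNReal.ofReal_lt_ofReal_iff_of_nonneg ha0 |>.2 haf)
  rw [← hconv u hu0 hu hfgi] at hb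
  have hb0 : b ≠ 0 := (zero_le.trans_lt hab).ne'
  have hbtop : b ≠ ∞ := (hb.trans_le le_top).ne
  have htest : ∀ i (k : X → ℝ≥0∞), Measurable k → N i k ≤ c → ∫⁻ x, k x * H x ∂μ ≤ b := by
    intro i k hk hNk
    -- Bounded functions lie in `L²(ν)` because `ν` is finite, so truncations are legitimate tests.
    refine lintegral_mul_le_of_min hk hHm fun n => ?_
    have hfin : ∀ x, min (k x) (n : ℝ≥0∞) ≠ ∞ := fun x =>
      ((min_le_right _ _).trans_lt (ENNReal.natCast_lt_top n)).ne
    have hm : Measurable fun x => (min (k x) (n : ℝ≥0∞)).toReal :=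
      (hk.min measurable_const).ennreal_toReal
    have hL : MemLp (fun x => (min (k x) (n : ℝ≥0∞)).toReal) 2 ν := by
      refine MemLp.of_bound hm.aestronglyMeasurable n (Eventually.of_forall fun x => ?_)
      rw [Real.norm_of_nonneg ENNReal.toReal_nonneg]
      exact ENNReal.toReal_le_of_le_ofReal (Nat.cast_nonneg n) (by simp)
    obtain ⟨h1, h2⟩ := hga i _ hL (fun x => ENNReal.toReal_nonneg) hm
      (((hN i).mono (Eventually.of_forall fun x => by
        rw [ENNReal.ofReal_toReal (hfin x)]; exact min_le_left _ _)).trans hNk)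
    have h3 := hconv _ (fun x => ENNReal.toReal_nonneg) hm h1
    simp_rw [ENNReal.ofReal_toReal (hfin _)] at h3
    rw [h3]
    exact (ENNReal.ofReal_le_ofReal h2).trans hab.le
  refine ⟨fun x => c / b * H x, hHm.const_mul _, fun i k hk hNk => ?_, ?_⟩
  · have h := htest i (fun x => c * k x) (hk.const_mul c)
      (by rw [(hN i).const_mul c hk]; exact mul_le_of_le_one_right' hNk)
    calc ∫⁻ x, k x * (c / b * H x) ∂μ = ∫⁻ x, b⁻¹ * (c * k x * H x) ∂μ :=
          lintegral_congr fun x => by rw [div_eq_mul_inv]; ring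
      _ = b⁻¹ * ∫⁻ x, c * k x * H x ∂μ := lintegral_const_mul _ ((hk.const_mul c).mul hHm)
      _ ≤ b⁻¹ * b := by gcongr
      _ = 1 := ENNReal.inv_mul_cancel hb0 hbtop
  · calc c = c / b * b := (ENNReal.div_mul_cancel hb0 hbtop).symm
      _ < c / b * ∫⁻ x, ENNReal.ofReal (u x) * H x ∂μ :=
          (ENNReal.mul_lt_mul_iff_right (ENNReal.div_pos hc0 hbtop).ne'
            (ENNReal.div_ne_top hctop hb0)).2 hb
      _ = ∫⁻ x, c / b * (ENNReal.ofReal (u x) * H x) ∂μ :=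
          (lintegral_const_mul _ (hu.ennreal_ofReal.mul hHm)).symm
      _ = _ := lintegral_congr fun x => by ring

end Bipolar

/-! ### The four component norms: Hölder and duality -/

section Component

variable {X₁ X₂ : Type*} [MeasurableSpace X₁] [MeasurableSpace X₂]

/-- The norms of `L¹`, `L^∞`, `L^{1,∞}`, `L^{∞,1}` on nonnegative functions, in this order. -/
noncomputable def componentNorm (μ₁ : Measure X₁) (μ₂ : Measure X₂) :
    Fin 4 → (X₁ × X₂ → ℝ≥0∞) → ℝ≥0∞ :=
  ![fun u => ∫⁻ z, u z ∂μ₁.prod μ₂, fun u => essSup u (μ₁.prod μ₂),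
    fun u => essSup (fun x₂ => ∫⁻ x₁, u (x₁, x₂) ∂μ₁) μ₂,
    fun u => ∫⁻ x₂, essSup (fun x₁ => u (x₁, x₂)) μ₁ ∂μ₂]

theorem essSup_add_le {X : Type*} [MeasurableSpace X] {μ : Measure X} (u v : X → ℝ≥0∞) :
    essSup (fun x => u x + v x) μ ≤ essSup u μ + essSup v μ := by
  refine essSup_le_of_ae_le _ ?_
  filter_upwards [ENNReal.ae_le_essSup u, ENNReal.ae_le_essSup v] with x hu hv
  exact add_le_add hu hv

theorem essSup_liminf_le {X : Type*} [MeasurableSpace X] {μ : Measure X} (u : ℕ → X → ℝ≥0∞) :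
    essSup (fun x => liminf (fun n => u n x) atTop) μ ≤ liminf (fun n => essSup (u n) μ) atTop := by
  refine essSup_le_of_ae_le _ ?_
  filter_upwards [ae_all_iff.2 fun n => ENNReal.ae_le_essSup (μ := μ) (u n)] with x hx
  exact liminf_le_liminf (Eventually.of_forall hx)

variable {μ₁ : Measure X₁} {μ₂ : Measure X₂} [SigmaFinite μ₁]

/-- The essential supremum of a section exceeds `c` exactly when the section of `{u > c}` has
positive measure, which is a measurable condition on `x₂`. -/
theorem measurable_essSup_section {u : X₁ × X₂ → ℝ≥0∞} (hu : Measurable u) :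
    Measurable fun x₂ => essSup (fun x₁ => u (x₁, x₂)) μ₁ := by
  refine measurable_of_Ioi fun c => ?_
  have hs : MeasurableSet {z : X₁ × X₂ | c < u z} := measurableSet_lt measurable_const hu
  have key : (fun x₂ => essSup (fun x₁ => u (x₁, x₂)) μ₁) ⁻¹' Set.Ioi c
      = (fun x₂ => μ₁ ((fun x₁ => (x₁, x₂)) ⁻¹' {z : X₁ × X₂ | c < u z})) ⁻¹' {0}ᶜ := by
    ext x₂
    rw [Set.mem_preimage, Set.mem_Ioi, Set.mem_preimage, Set.mem_compl_singleton_iff, ← not_le,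
      ne_eq, not_iff_not]
    have hiff : (∀ᵐ x₁ ∂μ₁, u (x₁, x₂) ≤ c) ↔ essSup (fun x₁ => u (x₁, x₂)) μ₁ ≤ c :=
      ⟨essSup_le_of_ae_le c, fun h =>
        (ENNReal.ae_le_essSup fun x₁ => u (x₁, x₂)).mono fun x hx => hx.trans h⟩
    rw [← hiff, ae_iff]
    simp only [not_le]
    rfl
  rw [key]
  exact measurable_measure_prodMk_right hs (measurableSet_singleton _).compl

theorem ae_ae_le_of_ae_le_prod [SigmaFinite μ₂] {u v : X₁ × X₂ → ℝ≥0∞}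
    (h : u ≤ᵐ[μ₁.prod μ₂] v) : ∀ᵐ x₂ ∂μ₂, ∀ᵐ x₁ ∂μ₁, u (x₁, x₂) ≤ v (x₁, x₂) :=
  Measure.ae_ae_of_ae_prod
    ((Measure.measurePreserving_swap (μ := μ₂) (ν := μ₁)).quasiMeasurePreserving.ae h)

theorem isFatouNorm_componentNorm [SigmaFinite μ₂] (i : Fin 4) :
    IsFatouNorm (μ₁.prod μ₂) (componentNorm μ₁ μ₂ i) := by
  fin_cases i
  · exact ⟨lintegral_mono_ae, fun hu _ => (lintegral_add_left hu _).le,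
      fun c u hu => lintegral_const_mul c hu, fun hu => lintegral_liminf_le hu⟩
  · exact ⟨essSup_mono_ae, fun _ _ => essSup_add_le _ _,
      fun c u _ => ENNReal.essSup_const_mul, fun _ => essSup_liminf_le _⟩
  · refine ⟨fun huv => essSup_mono_ae ?_, fun {u v} hu hv => ?_, fun c u hu => ?_,
      fun {u} hu => ?_⟩
    · exact (ae_ae_le_of_ae_le_prod huv).mono fun x hx => lintegral_mono_ae hx
    · refine le_trans (essSup_mono_ae (Eventually.of_forall fun x => ?_)) (essSup_add_le _ _)
      exact (lintegral_add_left (hu.comp measurable_prodMk_right) _).le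
    · simp only [componentNorm]
      change essSup _ _ = c * essSup _ _
      rw [← ENNReal.essSup_const_mul]
      congr 1
      exact funext fun x => lintegral_const_mul c (hu.comp measurable_prodMk_right)
    · refine le_trans (essSup_mono_ae (Eventually.of_forall fun x => ?_)) (essSup_liminf_le _)
      exact lintegral_liminf_le fun n => (hu n).comp measurable_prodMk_right
  · refine ⟨fun huv => lintegral_mono_ae ?_, fun {u v} hu hv => ?_, fun c u hu => ?_,
      fun {u} hu => ?_⟩
    · exact (ae_ae_le_of_ae_le_prod huv).mono fun x hx => essSup_mono_ae hx
    · exact (lintegral_mono fun x => essSup_add_le _ _).trans_eq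
        (lintegral_add_left (measurable_essSup_section hu) _)
    · refine Eq.trans (lintegral_congr fun x => ?_)
        (lintegral_const_mul c (measurable_essSup_section hu))
      exact ENNReal.essSup_const_mul
    · exact (lintegral_mono fun x => essSup_liminf_le _).trans
        (lintegral_liminf_le fun n => measurable_essSup_section (hu n))

theorem lintegral_mul_le_lintegral_mul_essSup {X : Type*} [MeasurableSpace X] {μ : Measure X}
    {u : X → ℝ≥0∞} (hu : Measurable u) (g : X → ℝ≥0∞) :
    ∫⁻ x, u x * g x ∂μ ≤ (∫⁻ x, u x ∂μ) * essSup g μ := by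
  rw [← lintegral_mul_const _ hu]
  refine lintegral_mono_ae ?_
  filter_upwards [ENNReal.ae_le_essSup g] with x hx
  gcongr

/-- Hölder's inequality for the four components. -/
theorem lintegral_mul_le_componentNorm_mul [SigmaFinite μ₂] {u g : X₁ × X₂ → ℝ≥0∞}
    (hu : Measurable u) (hg : Measurable g) {M : ℝ≥0∞}
    (hM : ∀ j, componentNorm μ₁ μ₂ j g ≤ M) (i : Fin 4) :
    ∫⁻ z, u z * g z ∂μ₁.prod μ₂ ≤ componentNorm μ₁ μ₂ i u * M := by
  fin_cases i
  · refine (lintegral_mul_le_lintegral_mul_essSup hu g).trans ?_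
    gcongr
    exacts [le_rfl, hM 1]
  · simp_rw [mul_comm (u _)]
    refine (lintegral_mul_le_lintegral_mul_essSup hg u).trans ?_
    rw [mul_comm]
    gcongr
    exacts [le_rfl, hM 0]
  · rw [lintegral_prod_symm' (fun z => u z * g z) (hu.mul hg)]
    calc ∫⁻ y, ∫⁻ x, u (x, y) * g (x, y) ∂μ₁ ∂μ₂
        ≤ ∫⁻ y, essSup (fun x => g (x, y)) μ₁ * ∫⁻ x, u (x, y) ∂μ₁ ∂μ₂ := by
          refine lintegral_mono fun y => ?_
          rw [mul_comm]
          exact lintegral_mul_le_lintegral_mul_essSup (hu.comp measurable_prodMk_right) _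
      _ ≤ (∫⁻ y, essSup (fun x => g (x, y)) μ₁ ∂μ₂)
            * essSup (fun y => ∫⁻ x, u (x, y) ∂μ₁) μ₂ :=
          lintegral_mul_le_lintegral_mul_essSup (measurable_essSup_section hg) _
      _ ≤ _ := by
          rw [mul_comm]
          gcongr
          exacts [le_rfl, hM 3]
  · rw [lintegral_prod_symm' (fun z => u z * g z) (hu.mul hg)]
    calc ∫⁻ y, ∫⁻ x, u (x, y) * g (x, y) ∂μ₁ ∂μ₂
        ≤ ∫⁻ y, essSup (fun x => u (x, y)) μ₁ * ∫⁻ x, g (x, y) ∂μ₁ ∂μ₂ := by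
          refine lintegral_mono fun y => ?_
          simp_rw [mul_comm (u _), mul_comm (essSup _ _)]
          exact lintegral_mul_le_lintegral_mul_essSup (hg.comp measurable_prodMk_right) _
      _ ≤ (∫⁻ y, essSup (fun x => u (x, y)) μ₁ ∂μ₂)
            * essSup (fun y => ∫⁻ x, g (x, y) ∂μ₁) μ₂ :=
          lintegral_mul_le_lintegral_mul_essSup (measurable_essSup_section hu) _
      _ ≤ _ := by
          gcongr
          exacts [le_rfl, hM 2]

theorem lintegral_mul_le_sumNorm_mul [SigmaFinite μ₂] {u g : X₁ × X₂ → ℝ≥0∞}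
    (hg : Measurable g) {M : ℝ≥0∞} (hM0 : M ≠ 0) (hMtop : M ≠ ∞)
    (hM : ∀ j, componentNorm μ₁ μ₂ j g ≤ M) :
    ∫⁻ z, u z * g z ∂μ₁.prod μ₂ ≤ sumNorm (μ₁.prod μ₂) (componentNorm μ₁ μ₂) u * M := by
  rw [sumNorm, ENNReal.iInf_mul_of_ne hM0 hMtop]
  refine le_iInf fun v => ?_
  calc ∫⁻ z, u z * g z ∂μ₁.prod μ₂ ≤ ∫⁻ z, ∑ i, v.1 i z * g z ∂μ₁.prod μ₂ := by
        refine lintegral_mono_ae ?_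
        filter_upwards [v.2.2] with z hz
        rw [← Finset.sum_mul]
        gcongr
    _ = ∑ i, ∫⁻ z, v.1 i z * g z ∂μ₁.prod μ₂ :=
        lintegral_finsetSum _ fun i _ => (v.2.1 i).mul hg
    _ ≤ _ := by
        rw [Finset.sum_mul]
        exact Finset.sum_le_sum fun i _ => lintegral_mul_le_componentNorm_mul (v.2.1 i) hg hM i

theorem exists_pos_measurable_le_one_lintegral_le_one {X : Type*} [MeasurableSpace X]
    (μ : Measure X) [SigmaFinite μ] :
    ∃ w : X → ℝ≥0∞, Measurable w ∧ (∀ x, w x ≠ 0) ∧ (∀ x, w x ≤ 1) ∧ ∫⁻ x, w x ∂μ ≤ 1 := by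
  obtain ⟨w, hw, hwm, hwi⟩ := exists_pos_lintegral_lt_of_sigmaFinite μ one_ne_zero
  refine ⟨fun x => min (w x) 1, hwm.coe_nnreal_ennreal.min measurable_const, fun x => ?_,
    fun x => min_le_right _ _, (lintegral_mono fun x => min_le_left _ _).trans hwi.le⟩
  exact (lt_min (by exact_mod_cast hw x) one_pos).ne'

/-- There is a strictly positive function whose four component norms are at most one. -/
theorem exists_pos_componentNorm_le_one (μ₁ : Measure X₁) (μ₂ : Measure X₂) [SigmaFinite μ₁]
    [SigmaFinite μ₂] : ∃ g : X₁ × X₂ → ℝ≥0∞, Measurable g ∧ (∀ z, g z ≠ 0) ∧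
      ∀ j, componentNorm μ₁ μ₂ j g ≤ 1 := by
  obtain ⟨a, ham, ha0, ha1, hai⟩ := exists_pos_measurable_le_one_lintegral_le_one μ₁
  obtain ⟨b, hbm, hb0, hb1, hbi⟩ := exists_pos_measurable_le_one_lintegral_le_one μ₂
  refine ⟨fun z => a z.1 * b z.2, by fun_prop, fun z => mul_ne_zero (ha0 _) (hb0 _), fun j => ?_⟩
  fin_cases j
  · exact (lintegral_prod_mul ham.aemeasurable hbm.aemeasurable).trans_le (mul_le_one' hai hbi)
  · exact essSup_le_of_ae_le _ (Eventually.of_forall fun z => mul_le_one' (ha1 _) (hb1 _))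
  · refine essSup_le_of_ae_le _ (Eventually.of_forall fun y => ?_)
    exact (lintegral_mul_const _ ham).trans_le (mul_le_one' hai (hb1 y))
  · refine (lintegral_mono fun y => ?_).trans hbi
    exact essSup_le_of_ae_le _ (Eventually.of_forall fun x => mul_le_of_le_one_left' (ha1 x))

/-- The `L^∞`-norm is dominated by the dual norm of `L¹`. -/
theorem essSup_le_one_of_dual {X : Type*} [MeasurableSpace X] {μ : Measure X} [SigmaFinite μ]
    {G : X → ℝ≥0∞} (hG : Measurable G)
    (h : ∀ k : X → ℝ≥0∞, Measurable k → ∫⁻ x, k x ∂μ ≤ 1 → ∫⁻ x, k x * G x ∂μ ≤ 1) :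
    essSup G μ ≤ 1 := by
  refine essSup_le_of_ae_le _ (ae_le_of_forall_setLIntegral_le_of_sigmaFinite hG
    fun s hs hμs => ?_)
  rw [setLIntegral_const, one_mul]
  by_cases h0 : μ s = 0
  · rw [setLIntegral_measure_zero _ _ h0]
    exact zero_le
  have hk := h (s.indicator fun _ => (μ s)⁻¹) (measurable_const.indicator hs)
    (by rw [lintegral_indicator_const hs, ENNReal.inv_mul_cancel h0 hμs.ne])
  have heq : ∀ x, s.indicator (fun _ => (μ s)⁻¹) x * G x = (μ s)⁻¹ * s.indicator G x := by
    intro x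
    by_cases hx : x ∈ s <;> simp [hx]
  simp_rw [heq] at hk
  rwa [lintegral_const_mul _ (hG.indicator hs), lintegral_indicator hs,
    ENNReal.inv_mul_le_iff h0 hμs.ne, mul_one] at hk

/-- The `L^{∞,1}`-norm is dominated by the dual norm of `L^{1,∞}`. -/
theorem lintegral_essSup_le_one_of_dual [SigmaFinite μ₂] {G : X₁ × X₂ → ℝ≥0∞}
    (hG : Measurable G)
    (h : ∀ k : X₁ × X₂ → ℝ≥0∞, Measurable k → (∀ x₂, ∫⁻ x₁, k (x₁, x₂) ∂μ₁ ≤ 1) →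
      ∫⁻ z, k z * G z ∂μ₁.prod μ₂ ≤ 1) :
    ∫⁻ x₂, essSup (fun x₁ => G (x₁, x₂)) μ₁ ∂μ₂ ≤ 1 := by
  obtain ⟨w, hwm, hw0, -, hwi⟩ := exists_pos_measurable_le_one_lintegral_le_one μ₁
  set φ : X₂ → ℝ≥0∞ := fun x₂ => essSup (fun x₁ => G (x₁, x₂)) μ₁ with hφ
  have hφm : Measurable φ := measurable_essSup_section hG
  -- Where `φ ≠ 0`, the level `ψ` lies strictly below the essential supremum, so `{G > ψ}` has a
  -- section of positive measure. The weight `w` on that set, normalised on each fibre by its mass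
  -- `m`, is a test function of fibre mass at most 1 whose pairing with `G` is at least `∫ ψ`.
  have key : ∀ ψ : X₂ → ℝ≥0∞, Measurable ψ → (∀ y, φ y ≠ 0 → ψ y < φ y) → (∀ y, ψ y ≤ φ y) →
      ∫⁻ y, ψ y ∂μ₂ ≤ 1 := by
    intro ψ hψ hlt hle
    set A : Set (X₁ × X₂) := {z | ψ z.2 < G z} with hA
    have hAm : MeasurableSet A := measurableSet_lt (hψ.comp measurable_snd) hG
    set K : X₁ × X₂ → ℝ≥0∞ := A.indicator fun z => w z.1 with hK
    have hKm : Measurable K := (hwm.comp measurable_fst).indicator hAm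
    have hKy : ∀ y, Measurable fun x => K (x, y) := fun y => hKm.comp measurable_prodMk_right
    set m : X₂ → ℝ≥0∞ := fun y => ∫⁻ x, K (x, y) ∂μ₁ with hm
    have hmm : Measurable m := hKm.lintegral_prod_left'
    have hmtop : ∀ y, m y ≠ ∞ := fun y => ((lintegral_mono fun x =>
      Set.indicator_le_self A (fun z => w z.1) (x, y)).trans hwi).trans_lt ENNReal.one_lt_top |>.ne
    have hm0 : ∀ y, φ y ≠ 0 → m y ≠ 0 := by
      intro y hy h0
      replace h0 := (lintegral_eq_zero_iff (hKy y)).1 h0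
      refine (hlt y hy).not_ge (essSup_le_of_ae_le _ ?_)
      filter_upwards [h0] with x hx
      by_contra hcon
      have hmem : (x, y) ∈ A := not_le.1 hcon
      simp only [hK, Set.indicator_of_mem hmem, Pi.zero_apply] at hx
      exact hw0 x hx
    have hk := h (fun z => (m z.2)⁻¹ * K z) ((hmm.comp measurable_snd).inv.mul hKm) fun y => by
      dsimp only
      rw [lintegral_const_mul _ (hKy y)]
      exact ENNReal.inv_mul_le_one _
    refine le_trans ?_ hk
    rw [lintegral_prod_symm' (fun z => (m z.2)⁻¹ * K z * G z)
      (((hmm.comp measurable_snd).inv.mul hKm).mul hG)]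
    refine lintegral_mono fun y => ?_
    by_cases hy : φ y = 0
    · exact (hle y).trans (hy.le.trans zero_le)
    calc ψ y = (m y)⁻¹ * m y * ψ y := by
          rw [ENNReal.inv_mul_cancel (hm0 y hy) (hmtop y), one_mul]
      _ = ∫⁻ x, (m y)⁻¹ * K (x, y) * ψ y ∂μ₁ := by
          rw [lintegral_mul_const _ ((hKy y).const_mul _),
            lintegral_const_mul _ (hKy y)]
      _ ≤ _ := by
          refine lintegral_mono fun x => ?_
          by_cases hx : (x, y) ∈ A
          · have : ψ y ≤ G (x, y) := le_of_lt hx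
            dsimp only
            gcongr
          · simp [hK, hx]
  -- Take `ψ = θ * min φ n` with `θ < 1`; truncation is needed since `φ` may be infinite, where
  -- scaling by a nonzero `θ` gives no strict inequality.
  have hfin : ∀ n : ℕ, ∫⁻ y, min (φ y) n ∂μ₂ ≤ 1 := by
    intro n
    rw [← one_mul (∫⁻ y, min (φ y) n ∂μ₂)]
    refine ENNReal.mul_le_of_forall_lt fun θ hθ t ht => ?_
    refine (mul_le_mul_right ht.le θ).trans ?_
    rw [← lintegral_const_mul _ (hφm.min measurable_const)]
    have hle : ∀ y, θ * min (φ y) n ≤ φ y := fun y =>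
      (mul_le_of_le_one_left' hθ.le).trans (min_le_left _ _)
    refine key _ ((hφm.min measurable_const).const_mul _) (fun y hy => ?_) hle
    rcases Nat.eq_zero_or_pos n with rfl | hn
    · simpa using pos_iff_ne_zero.2 hy
    have h0 : min (φ y) (n : ℝ≥0∞) ≠ 0 :=
      (lt_min (pos_iff_ne_zero.2 hy) (by exact_mod_cast hn)).ne'
    have ht : min (φ y) (n : ℝ≥0∞) ≠ ∞ :=
      ((min_le_right _ _).trans_lt (ENNReal.natCast_lt_top n)).ne
    calc θ * min (φ y) n < 1 * min (φ y) n := (ENNReal.mul_lt_mul_iff_left h0 ht).2 hθ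
      _ ≤ φ y := by rw [one_mul]; exact min_le_left _ _
  have := lintegral_mul_le_of_min (μ := μ₂) (a := 1) hφm (measurable_const (a := (1 : ℝ≥0∞)))
    (by simpa using hfin)
  simpa using this

/-- Each component norm is controlled by testing in its partner space: the constant 1 for `L¹`,
normalised indicators for `L^∞`, functions of `x₂` alone for `L^{1,∞}`, and fibrewise normalised
functions for `L^{∞,1}`. -/
theorem componentNorm_le_one_of_dual [SigmaFinite μ₂] {G : X₁ × X₂ → ℝ≥0∞} (hG : Measurable G)
    (h : ∀ i (k : X₁ × X₂ → ℝ≥0∞), Measurable k → componentNorm μ₁ μ₂ i k ≤ 1 →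
      ∫⁻ z, k z * G z ∂μ₁.prod μ₂ ≤ 1) (j : Fin 4) : componentNorm μ₁ μ₂ j G ≤ 1 := by
  fin_cases j
  · have h1 := h 1 (fun _ => 1) measurable_const
      (essSup_le_of_ae_le _ (Eventually.of_forall fun _ => le_rfl))
    simp_rw [one_mul] at h1
    exact h1
  · exact essSup_le_one_of_dual hG (h 0)
  · refine essSup_le_one_of_dual (hG.lintegral_prod_left') fun k hk hk1 => ?_
    refine le_trans (Eq.le ?_) (h 3 (fun z => k z.2) (hk.comp measurable_snd)
      ((lintegral_mono fun y => ?_).trans hk1))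
    · rw [lintegral_prod_symm' (fun z => k z.2 * G z) ((hk.comp measurable_snd).mul hG)]
      exact lintegral_congr fun y =>
        (lintegral_const_mul _ (hG.comp measurable_prodMk_right)).symm
    · exact essSup_le_of_ae_le _ (Eventually.of_forall fun _ => le_rfl)
  · exact lintegral_essSup_le_one_of_dual hG fun k hk hk1 =>
      h 2 k hk (essSup_le_of_ae_le _ (Eventually.of_forall hk1))

end Component

/-! ### The intersection and sum spaces -/

section Spaces

variable {X₁ X₂ : Type*} [MeasurableSpace X₁] [MeasurableSpace X₂] {μ₁ : Measure X₁}
  {μ₂ : Measure X₂}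

theorem eLpNorm_one_eq_componentNorm (f : X₁ × X₂ → ℂ) :
    eLpNorm f 1 (μ₁.prod μ₂) = componentNorm μ₁ μ₂ 0 fun z => ‖f z‖ₑ :=
  eLpNorm_one_eq_lintegral_enorm

theorem eLpNorm_top_eq_componentNorm (f : X₁ × X₂ → ℂ) :
    eLpNorm f ∞ (μ₁.prod μ₂) = componentNorm μ₁ μ₂ 1 fun z => ‖f z‖ₑ :=
  eLpNorm_exponent_top

theorem mixedENorm_one_top_eq_componentNorm (f : X₁ × X₂ → ℂ) :
    mixedENorm 1 ∞ μ₁ μ₂ f = componentNorm μ₁ μ₂ 2 fun z => ‖f z‖ₑ := by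
  simp [mixedENorm, eLpNorm_exponent_top, eLpNormEssSup, eLpNorm_one_eq_lintegral_enorm,
    componentNorm]

theorem mixedENorm_top_one_eq_componentNorm (f : X₁ × X₂ → ℂ) :
    mixedENorm ∞ 1 μ₁ μ₂ f = componentNorm μ₁ μ₂ 3 fun z => ‖f z‖ₑ := by
  simp [mixedENorm, eLpNorm_exponent_top, eLpNormEssSup, eLpNorm_one_eq_lintegral_enorm,
    componentNorm]

theorem interENorm_le_iff {f : X₁ × X₂ → ℂ} {M : ℝ≥0∞} :
    interENorm μ₁ μ₂ f ≤ M ↔ ∀ j, componentNorm μ₁ μ₂ j (fun z => ‖f z‖ₑ) ≤ M := by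
  simp only [interENorm, max_le_iff, eLpNorm_one_eq_componentNorm, eLpNorm_top_eq_componentNorm,
    mixedENorm_one_top_eq_componentNorm, mixedENorm_top_one_eq_componentNorm, Fin.forall_fin_succ, and_assoc]
  simp

/-- A complex function dominated in modulus by a sum of four functions splits accordingly. -/
theorem exists_decomposition {ι : Type*} [Fintype ι] {X : Type*} [MeasurableSpace X] {f : X → ℂ}
    (hf : Measurable f) {v : ι → X → ℝ≥0∞} (hv : ∀ i, Measurable (v i)) :
    ∃ F : ι → X → ℂ, (∀ i, Measurable (F i)) ∧ (∀ i x, ‖F i x‖ₑ ≤ v i x) ∧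
      ∀ x, ‖f x‖ₑ ≤ ∑ i, v i x → f x = ∑ i, F i x := by
  -- Capping by `‖f‖ₑ` makes the weights finite while keeping their sum at least `‖f‖ₑ` wherever
  -- domination holds; each piece is then `f` times the fraction `t i / T`.
  set t : ι → X → ℝ≥0∞ := fun i x => min (v i x) ‖f x‖ₑ with ht
  have htm : ∀ i, Measurable (t i) := fun i => (hv i).min hf.enorm
  set T : X → ℝ≥0∞ := fun x => max (∑ i, t i x) ‖f x‖ₑ with hT
  have hTm : Measurable T := (Finset.measurable_fun_sum _ fun i _ => htm i).max hf.enorm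
  have htT : ∀ i x, t i x ≤ T x := fun i x => le_max_of_le_left
    (Finset.single_le_sum (f := fun i => t i x) (fun _ _ => zero_le) (Finset.mem_univ i))
  have hTtop : ∀ x, T x ≠ ∞ := fun x => (max_lt (ENNReal.sum_lt_top.2 fun i _ =>
    (min_le_right _ _).trans_lt enorm_lt_top) enorm_lt_top).ne
  have hsum : ∀ x, ‖f x‖ₑ ≤ ∑ i, v i x → ∑ i, t i x = T x := by
    intro x hx
    refine (max_eq_left ?_).symm
    by_cases h : ∃ i, ‖f x‖ₑ ≤ v i x
    · obtain ⟨i, hi⟩ := h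
      exact (le_min hi le_rfl).trans
        (Finset.single_le_sum (f := fun i => t i x) (fun _ _ => zero_le) (Finset.mem_univ i))
    · push Not at h
      exact hx.trans_eq (Finset.sum_congr rfl fun i _ => (min_eq_left (h i).le).symm)
  have hdiv : ∀ i x, t i x / T x ≠ ∞ := fun i x =>
    (ENNReal.div_le_of_le_mul (by rw [one_mul]; exact htT i x)).trans_lt ENNReal.one_lt_top |>.ne
  refine ⟨fun i x => f x * ((t i x / T x).toReal : ℂ), fun i => ?_, fun i x => ?_, fun x hx => ?_⟩
  · exact hf.mul (Complex.measurable_ofReal.comp ((htm i).div hTm).ennreal_toReal)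
  · have h : ‖((t i x / T x).toReal : ℂ)‖ₑ = t i x / T x := by
      rw [← ofReal_norm, Complex.norm_of_nonneg ENNReal.toReal_nonneg,
        ENNReal.ofReal_toReal (hdiv i x)]
    rw [enorm_mul, h, ← mul_div_assoc]
    refine ENNReal.div_le_of_le_mul ?_
    rw [mul_comm]
    gcongr
    exacts [min_le_left _ _, le_max_right _ _]
  · rcases eq_or_ne (f x) 0 with h0 | h0
    · simp [h0]
    have hT0 : T x ≠ 0 := ((enorm_pos.2 h0).trans_le (le_max_right _ _)).ne'
    rw [← Finset.mul_sum, ← Complex.ofReal_sum, ← ENNReal.toReal_sum fun i _ => hdiv i x]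
    simp_rw [div_eq_mul_inv]
    rw [← Finset.sum_mul, hsum x hx, ENNReal.mul_inv_cancel hT0 (hTtop x)]
    simp

theorem ae_coeFn_sum_range {X : Type*} [MeasurableSpace X] {μ : Measure X} (u : ℕ → X →ₘ[μ] ℂ)
    (n : ℕ) : ⇑(∑ k ∈ Finset.range n, u k) =ᵐ[μ] fun z => ∑ k ∈ Finset.range n, u k z := by
  induction n with
  | zero => exact AEEqFun.coeFn_zero
  | succ n ih =>
    rw [Finset.sum_range_succ]
    filter_upwards [AEEqFun.coeFn_add (∑ k ∈ Finset.range n, u k) (u n), ih] with z h1 h2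
    rw [h1, Pi.add_apply, h2, Finset.sum_range_succ]

variable [SigmaFinite μ₁] [SigmaFinite μ₂]

/-- One direction splits `f` proportionally to the dominating functions; the other is the triangle
inequality for moduli. -/
theorem sumENorm_eq_sumNorm {f : X₁ × X₂ → ℂ} (hf : Measurable f) :
    sumENorm μ₁ μ₂ f = sumNorm (μ₁.prod μ₂) (componentNorm μ₁ μ₂) fun z => ‖f z‖ₑ := by
  unfold sumENorm
  refine le_antisymm (le_iInf fun v => ?_) (le_sInf ?_)
  · obtain ⟨F, hFm, hFv, hF⟩ := exists_decomposition hf v.2.1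
    refine le_trans (sInf_le ⟨F 0, F 1, F 2, F 3, hFm 0, hFm 1, hFm 2, hFm 3, ?_, rfl⟩) ?_
    · filter_upwards [v.2.2] with z hz
      rw [hF z hz, Fin.sum_univ_four]
      rfl
    · rw [eLpNorm_one_eq_componentNorm, eLpNorm_top_eq_componentNorm,
        mixedENorm_one_top_eq_componentNorm, mixedENorm_top_one_eq_componentNorm,
        Fin.sum_univ_four]
      have h : ∀ i, componentNorm μ₁ μ₂ i (fun z => ‖F i z‖ₑ) ≤ componentNorm μ₁ μ₂ i (v.1 i) :=
        fun i => (isFatouNorm_componentNorm i).mono (Eventually.of_forall (hFv i))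
      gcongr <;> apply h
  · rintro _ ⟨f₁, f₂, f₃, f₄, h₁, h₂, h₃, h₄, h, rfl⟩
    rw [eLpNorm_one_eq_componentNorm, eLpNorm_top_eq_componentNorm,
        mixedENorm_one_top_eq_componentNorm, mixedENorm_top_one_eq_componentNorm]
    refine (sumNorm_le (v := ![fun z => ‖f₁ z‖ₑ, fun z => ‖f₂ z‖ₑ, fun z => ‖f₃ z‖ₑ,
      fun z => ‖f₄ z‖ₑ]) (fun i => ?_) ?_).trans_eq (Fin.sum_univ_four _)
    · fin_cases i
      exacts [h₁.enorm, h₂.enorm, h₃.enorm, h₄.enorm]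
    · filter_upwards [h] with z hz
      rw [hz, Fin.sum_univ_four]
      exact (enorm_add_le _ _).trans (add_le_add_left ((enorm_add_le _ _).trans
        (add_le_add_left (enorm_add_le _ _) _)) _)

theorem ae_eq_zero_of_sumNorm_eq_zero {u : X₁ × X₂ → ℝ≥0∞} (hu : Measurable u)
    (h : sumNorm (μ₁.prod μ₂) (componentNorm μ₁ μ₂) u = 0) : u =ᵐ[μ₁.prod μ₂] 0 := by
  obtain ⟨g, hg, hg0, hg1⟩ := exists_pos_componentNorm_le_one μ₁ μ₂
  have hle := lintegral_mul_le_sumNorm_mul (u := u) hg one_ne_zero ENNReal.one_ne_top hg1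
  rw [h, zero_mul, nonpos_iff_eq_zero] at hle
  filter_upwards [(lintegral_eq_zero_iff (hu.mul hg)).1 hle] with z hz
  exact (mul_eq_zero.1 hz).resolve_right (hg0 z)

theorem ae_lt_top_of_sumNorm_lt_top {u : X₁ × X₂ → ℝ≥0∞} (hu : Measurable u)
    (h : sumNorm (μ₁.prod μ₂) (componentNorm μ₁ μ₂) u < ∞) : ∀ᵐ z ∂μ₁.prod μ₂, u z < ∞ := by
  obtain ⟨g, hg, hg0, hg1⟩ := exists_pos_componentNorm_le_one μ₁ μ₂
  have hle := lintegral_mul_le_sumNorm_mul (u := u) hg one_ne_zero ENNReal.one_ne_top hg1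
  rw [mul_one] at hle
  filter_upwards [ae_lt_top (hu.mul hg) (hle.trans_lt h).ne] with z hz
  exact lt_top_iff_ne_top.2 fun hcon => hz.ne (by rw [Pi.mul_apply, hcon, ENNReal.top_mul (hg0 z)])

theorem sumENorm_add_le {f g : X₁ × X₂ → ℂ} (hf : Measurable f) (hg : Measurable g) :
    sumENorm μ₁ μ₂ (f + g) ≤ sumENorm μ₁ μ₂ f + sumENorm μ₁ μ₂ g := by
  rw [sumENorm_eq_sumNorm hf, sumENorm_eq_sumNorm hg, sumENorm_eq_sumNorm (hf.add hg)]
  exact (sumNorm_mono (Eventually.of_forall fun z => enorm_add_le _ _)).trans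
    (sumNorm_add_le isFatouNorm_componentNorm _ _)

theorem sumENorm_const_smul (c : ℂ) {f : X₁ × X₂ → ℂ} (hf : Measurable f) :
    sumENorm μ₁ μ₂ (c • f) = ‖c‖ₑ * sumENorm μ₁ μ₂ f := by
  rw [sumENorm_eq_sumNorm hf, sumENorm_eq_sumNorm (hf.const_smul c),
    ← sumNorm_const_mul isFatouNorm_componentNorm enorm_ne_top]
  simp only [Pi.smul_apply, enorm_smul]

theorem normedSpaceCore_sumSpace : NormedSpace.Core ℂ (sumSpace μ₁ μ₂) where
  norm_nonneg _ := ENNReal.toReal_nonneg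
  norm_smul c f := by
    change (sumENorm μ₁ μ₂ ((c • f.1 : (X₁ × X₂) →ₘ[μ₁.prod μ₂] ℂ))).toReal = _
    rw [sumENorm_congr (AEEqFun.coeFn_smul c f.1), sumENorm_const_smul c f.1.measurable,
      ENNReal.toReal_mul, toReal_enorm]
    rfl
  norm_triangle f g := by
    change (sumENorm μ₁ μ₂ ((f.1 + g.1 : (X₁ × X₂) →ₘ[μ₁.prod μ₂] ℂ))).toReal
      ≤ (sumENorm μ₁ μ₂ f.1).toReal + (sumENorm μ₁ μ₂ g.1).toReal
    have hf : sumENorm μ₁ μ₂ f.1 < ∞ := f.2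
    have hg : sumENorm μ₁ μ₂ g.1 < ∞ := g.2
    rw [sumENorm_congr (AEEqFun.coeFn_add f.1 g.1), ← ENNReal.toReal_add hf.ne hg.ne]
    exact ENNReal.toReal_mono (ENNReal.add_ne_top.2 ⟨hf.ne, hg.ne⟩)
      (sumENorm_add_le f.1.measurable g.1.measurable)
  norm_eq_zero_iff f := by
    change (sumENorm μ₁ μ₂ f.1).toReal = 0 ↔ f = 0
    have hf : sumENorm μ₁ μ₂ f.1 < ∞ := f.2
    rw [ENNReal.toReal_eq_zero_iff, or_iff_left hf.ne]
    constructor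
    · intro h
      rw [sumENorm_eq_sumNorm f.1.measurable] at h
      refine Subtype.ext (AEEqFun.ext ?_)
      filter_upwards [ae_eq_zero_of_sumNorm_eq_zero f.1.measurable.enorm h,
        AEEqFun.coeFn_zero (μ := μ₁.prod μ₂) (β := ℂ) (α := X₁ × X₂)] with z hz hz0
      rw [enorm_eq_zero.1 hz]
      exact hz0.symm
    · rintro rfl
      change sumENorm μ₁ μ₂ ((0 : (X₁ × X₂) →ₘ[μ₁.prod μ₂] ℂ)) = 0
      rw [sumENorm_congr AEEqFun.coeFn_zero, ← zero_smul ℂ (0 : X₁ × X₂ → ℂ),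
        sumENorm_const_smul 0 measurable_zero]
      simp

/-- An absolutely convergent series in the sum space has an a.e. limit `F`, and the norm of
`F` minus a partial sum is bounded by the tail of the series of norms. -/
theorem exists_sum_of_tsum_sumENorm_ne_top {u : ℕ → (X₁ × X₂) →ₘ[μ₁.prod μ₂] ℂ}
    (hu : ∑' n, sumENorm μ₁ μ₂ (u n) ≠ ∞) :
    ∃ F : (X₁ × X₂) →ₘ[μ₁.prod μ₂] ℂ, ∀ n,
      sumENorm μ₁ μ₂ (⇑(F - ∑ k ∈ Finset.range n, u k)) ≤ ∑' k, sumENorm μ₁ μ₂ (u (k + n)) := by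
  have hm : ∀ n, Measurable fun z => ‖u n z‖ₑ := fun n => (u n).measurable.enorm
  have hle : ∀ n, sumNorm (μ₁.prod μ₂) (componentNorm μ₁ μ₂) (fun z => ∑' k, ‖u (k + n) z‖ₑ)
      ≤ ∑' k, sumENorm μ₁ μ₂ (u (k + n)) := by
    intro n
    simp_rw [sumENorm_eq_sumNorm (u _).measurable]
    exact sumNorm_tsum_le isFatouNorm_componentNorm fun k z => ‖u (k + n) z‖ₑ
  have hfin : ∀ᵐ z ∂μ₁.prod μ₂, ∑' k, ‖u k z‖ₑ < ∞ :=
    ae_lt_top_of_sumNorm_lt_top (Measurable.tsum hm)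
      ((hle 0).trans_lt (lt_top_iff_ne_top.2 hu))
  have hsummable : ∀ᵐ z ∂μ₁.prod μ₂, Summable fun k => u k z := by
    filter_upwards [hfin] with z hz
    exact (tsum_enorm_ne_top_iff_summable_norm.1 hz.ne).of_norm
  have hF : AEStronglyMeasurable (fun z => ∑' k, u k z) (μ₁.prod μ₂) := by
    refine aestronglyMeasurable_of_tendsto_ae atTop
      (f := fun n z => ∑ k ∈ Finset.range n, u k z)
      (fun n => (Finset.measurable_fun_sum _ fun k _ => (u k).measurable).aestronglyMeasurable) ?_
    filter_upwards [hsummable] with z hz using hz.hasSum.tendsto_sum_nat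
  refine ⟨AEEqFun.mk _ hF, fun n => ?_⟩
  rw [sumENorm_eq_sumNorm (AEEqFun.measurable _)]
  refine le_trans (sumNorm_mono ?_) (hle n)
  filter_upwards [hsummable, AEEqFun.coeFn_sub (AEEqFun.mk _ hF) (∑ k ∈ Finset.range n, u k),
    AEEqFun.coeFn_mk _ hF, ae_coeFn_sum_range u n] with z hz h1 h2 h3
  rw [h1, Pi.sub_apply, h2, h3, ← hz.sum_add_tsum_nat_add n, add_sub_cancel_left]
  exact enorm_tsum_le_tsum_enorm

theorem isBanachSpace_sumSpace : IsBanachSpace (sumSpace μ₁ μ₂) := by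
  refine ⟨normedSpaceCore_sumSpace, ?_⟩
  let _ : NormedAddCommGroup (sumSpace μ₁ μ₂) :=
    NormedAddCommGroup.ofCore (𝕜 := ℂ) normedSpaceCore_sumSpace
  refine NormedAddCommGroup.completeSpace_of_summable_imp_tendsto fun u hu => ?_
  have hnorm : ∀ f : sumSpace μ₁ μ₂, ENNReal.ofReal ‖f‖ = sumENorm μ₁ μ₂ f.1 := fun f =>
    ENNReal.ofReal_toReal (ne_of_lt f.2)
  have hfin : ∑' n, sumENorm μ₁ μ₂ (u n).1 ≠ ∞ := by
    simp_rw [← hnorm]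
    exact hu.tsum_ofReal_ne_top
  obtain ⟨F, hF⟩ := exists_sum_of_tsum_sumENorm_ne_top (u := fun n => (u n).1) hfin
  have hFmem : F ∈ sumSpace μ₁ μ₂ := by
    have := hF 0
    rw [Finset.range_zero, Finset.sum_empty, sub_zero] at this
    exact this.trans_lt (lt_top_iff_ne_top.2 hfin)
  refine ⟨⟨F, hFmem⟩, ?_⟩
  rw [tendsto_iff_norm_sub_tendsto_zero]
  have hlim := ENNReal.tendsto_sum_nat_add (fun n => sumENorm μ₁ μ₂ (u n).1) hfin
  have hlim' : Tendsto (fun n => sumENorm μ₁ μ₂ (⇑(F - ∑ k ∈ Finset.range n, (u k).1))) atTop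
      (nhds 0) :=
    tendsto_of_tendsto_of_tendsto_of_le_of_le tendsto_const_nhds hlim (fun _ => zero_le) hF
  have hreal := (ENNReal.tendsto_toReal ENNReal.zero_ne_top).comp hlim'
  rw [ENNReal.toReal_zero] at hreal
  refine hreal.congr fun n => ?_
  rw [norm_sub_rev]
  change _ = (sumENorm μ₁ μ₂ (⇑(F - ((∑ k ∈ Finset.range n, u k : sumSpace μ₁ μ₂) :
    (X₁ × X₂) →ₘ[μ₁.prod μ₂] ℂ)))).toReal
  rw [Submodule.coe_sum]
  rfl

/-- A nonnegative function with component norms at most one defines an element of the unit ball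
of the intersection space. -/
theorem exists_interSpace_of_componentNorm_le_one {G : X₁ × X₂ → ℝ≥0∞} (hG : Measurable G)
    (h : ∀ j, componentNorm μ₁ μ₂ j G ≤ 1) :
    ∃ g : interSpace μ₁ μ₂, ‖g‖ ≤ 1 ∧ ∀ᵐ z ∂μ₁.prod μ₂, ‖g.1 z‖ₑ = G z := by
  have hgm : Measurable fun z => ((G z).toReal : ℂ) :=
    Complex.measurable_ofReal.comp hG.ennreal_toReal
  have hae : ∀ᵐ z ∂μ₁.prod μ₂, ‖AEEqFun.mk _ (hgm.aestronglyMeasurable (μ := μ₁.prod μ₂)) z‖ₑ = G z := by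
    filter_upwards [AEEqFun.coeFn_mk _ (hgm.aestronglyMeasurable (μ := μ₁.prod μ₂)),
      ENNReal.ae_le_essSup (μ := μ₁.prod μ₂) G] with z hz hz1
    have hGz : G z ≠ ∞ := ((hz1.trans (h 1)).trans_lt ENNReal.one_lt_top).ne
    rw [hz, ← ofReal_norm, Complex.norm_of_nonneg ENNReal.toReal_nonneg, ENNReal.ofReal_toReal hGz]
  have hle : interENorm μ₁ μ₂ (AEEqFun.mk _ (hgm.aestronglyMeasurable (μ := μ₁.prod μ₂))) ≤ 1 :=
    interENorm_le_iff.2 fun j =>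
      ((isFatouNorm_componentNorm j).mono (hae.mono fun z hz => hz.le)).trans (h j)
  exact ⟨⟨_, hle.trans_lt ENNReal.one_lt_top⟩, ENNReal.toReal_le_of_le_ofReal zero_le_one
    (by simpa using hle), hae⟩

theorem exists_dual_of_lt_sumENorm {f : X₁ × X₂ → ℂ} (hf : Measurable f) {c : ℝ≥0∞}
    (hc0 : c ≠ 0) (hc : c < sumENorm μ₁ μ₂ f) :
    ∃ G : X₁ × X₂ → ℝ≥0∞, Measurable G ∧ (∀ j, componentNorm μ₁ μ₂ j G ≤ 1) ∧
      c < ∫⁻ z, ‖f z‖ₑ * G z ∂μ₁.prod μ₂ := by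
  rw [sumENorm_eq_sumNorm hf] at hc
  simp_rw [← ofReal_norm] at hc ⊢
  obtain ⟨G, hG, hdual, hlt⟩ := exists_dual_of_lt_sumNorm isFatouNorm_componentNorm hf.norm
    (fun z => norm_nonneg _) hc0 hc
  exact ⟨G, hG, componentNorm_le_one_of_dual hG hdual, hlt⟩

theorem lintegral_mul_interSpace_lt_top {f : X₁ × X₂ → ℂ} (hf : Measurable f)
    (hfin : sumENorm μ₁ μ₂ f < ∞) (g : interSpace μ₁ μ₂) :
    ∫⁻ z, ‖f z * g.1 z‖ₑ ∂μ₁.prod μ₂ < ∞ := by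
  have hg : interENorm μ₁ μ₂ g.1 < ∞ := g.2
  -- The maximum with 1 keeps the Hölder constant nonzero, as needed to pull it through the infimum.
  have hM : max (interENorm μ₁ μ₂ g.1) 1 ≠ ∞ := (max_lt hg ENNReal.one_lt_top).ne
  simp_rw [enorm_mul]
  rw [sumENorm_eq_sumNorm hf] at hfin
  exact (lintegral_mul_le_sumNorm_mul g.1.measurable.enorm
    (one_pos.trans_le (le_max_right _ _)).ne' hM
    (interENorm_le_iff.1 (le_max_left _ _))).trans_lt
    (ENNReal.mul_lt_top hfin (lt_top_iff_ne_top.2 hM))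

theorem iSup_lintegral_mul_le_sumENorm {f : X₁ × X₂ → ℂ} (hf : Measurable f) :
    (⨆ (g : interSpace μ₁ μ₂) (_ : ‖g‖ ≤ 1), ∫⁻ z, ‖f z * g.1 z‖ₑ ∂μ₁.prod μ₂)
      ≤ sumENorm μ₁ μ₂ f := by
  refine iSup₂_le fun g hg => ?_
  have hg1 : interENorm μ₁ μ₂ g.1 ≤ 1 := by
    have := ENNReal.ofReal_le_ofReal hg
    rwa [ENNReal.ofReal_one, show ‖g‖ = (interENorm μ₁ μ₂ g.1).toReal from rfl,
      ENNReal.ofReal_toReal (ne_of_lt g.2)] at this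
  simp_rw [enorm_mul]
  rw [sumENorm_eq_sumNorm hf]
  exact (lintegral_mul_le_sumNorm_mul g.1.measurable.enorm one_ne_zero ENNReal.one_ne_top
    (interENorm_le_iff.1 hg1)).trans_eq (mul_one _)

theorem sumENorm_le_iSup_lintegral_mul {f : X₁ × X₂ → ℂ} (hf : Measurable f) :
    sumENorm μ₁ μ₂ f
      ≤ ⨆ (g : interSpace μ₁ μ₂) (_ : ‖g‖ ≤ 1), ∫⁻ z, ‖f z * g.1 z‖ₑ ∂μ₁.prod μ₂ := by
  refine le_of_forall_lt fun c hc => ?_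
  obtain ⟨d, hcd, hd⟩ := exists_between hc
  obtain ⟨G, hG, hG1, hlt⟩ := exists_dual_of_lt_sumENorm hf (zero_le.trans_lt hcd).ne' hd
  obtain ⟨g, hg, hgG⟩ := exists_interSpace_of_componentNorm_le_one hG hG1
  refine hcd.trans (hlt.trans_le (le_iSup₂_of_le g hg (lintegral_mono_ae ?_)))
  filter_upwards [hgG] with z hz
  rw [enorm_mul, hz]

/-- If `f` is not in the sum space, a single `g` in the intersection space detects this. -/
theorem exists_lintegral_mul_eq_top {f : X₁ × X₂ → ℂ} (hf : Measurable f)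
    (htop : sumENorm μ₁ μ₂ f = ∞) :
    ∃ g : interSpace μ₁ μ₂, ∫⁻ z, ‖f z * g.1 z‖ₑ ∂μ₁.prod μ₂ = ∞ := by
  -- The factor `2 ^ (n + 1)` cancels the weight of `G n` in the series `H`, leaving a contribution
  -- of at least `n + 1`; the weights sum to 1, so `H` stays in the unit ball.
  choose G hG hG1 hlt using fun n : ℕ => exists_dual_of_lt_sumENorm (μ₁ := μ₁) (μ₂ := μ₂) hf
    (c := 2 ^ (n + 1) * (n + 1)) (by positivity)
    (by rw [htop]; exact ENNReal.mul_lt_top (by simp) (by simp))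
  set H : X₁ × X₂ → ℝ≥0∞ := fun z => ∑' n : ℕ, (2 ^ (n + 1))⁻¹ * G n z with hH
  have hHm : Measurable H := Measurable.tsum fun n => (hG n).const_mul _
  have hH1 : ∀ j, componentNorm μ₁ μ₂ j H ≤ 1 := by
    intro j
    refine ((isFatouNorm_componentNorm j).tsum_le fun n => (hG n).const_mul _).trans ?_
    simp_rw [(isFatouNorm_componentNorm j).const_mul _ (hG _)]
    refine (ENNReal.tsum_le_tsum fun n => mul_le_of_le_one_right' (hG1 n j)).trans_eq ?_
    simp_rw [ENNReal.inv_pow]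
    rw [ENNReal.tsum_geometric_add_one, ENNReal.one_sub_inv_two, inv_inv,
      ENNReal.inv_mul_cancel two_ne_zero ENNReal.ofNat_ne_top]
  obtain ⟨g, -, hg⟩ := exists_interSpace_of_componentNorm_le_one hHm hH1
  refine ⟨g, ENNReal.eq_top_of_forall_nnreal_le fun r => ?_⟩
  obtain ⟨n, hn⟩ := exists_nat_ge r
  have h2 : ((2 : ℝ≥0∞) ^ (n + 1)) ≠ 0 := by positivity
  have h2' : ((2 : ℝ≥0∞) ^ (n + 1)) ≠ ∞ := by simp
  calc (r : ℝ≥0∞) ≤ n := by exact_mod_cast hn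
    _ ≤ n + 1 := le_self_add
    _ = (2 ^ (n + 1))⁻¹ * (2 ^ (n + 1) * (n + 1)) := by
        rw [← mul_assoc, ENNReal.inv_mul_cancel h2 h2', one_mul]
    _ ≤ (2 ^ (n + 1))⁻¹ * ∫⁻ z, ‖f z‖ₑ * G n z ∂μ₁.prod μ₂ := by
        gcongr
        exact (hlt n).le
    _ = ∫⁻ z, (2 ^ (n + 1))⁻¹ * (‖f z‖ₑ * G n z) ∂μ₁.prod μ₂ :=
        (lintegral_const_mul _ (hf.enorm.mul (hG n))).symm
    _ ≤ ∫⁻ z, ‖f z * g.1 z‖ₑ ∂μ₁.prod μ₂ := by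
        refine lintegral_mono_ae ?_
        filter_upwards [hg] with z hz
        rw [enorm_mul, hz, mul_left_comm]
        gcongr
        exact ENNReal.le_tsum (f := fun n : ℕ => (2 ^ (n + 1))⁻¹ * G n z) n

end Spaces

end MixedLebesgue

theorem mainTheorem8 {X₁ X₂ : Type*} [MeasurableSpace X₁] [MeasurableSpace X₂]
    (μ₁ : Measure X₁) (μ₂ : Measure X₂) [SigmaFinite μ₁] [SigmaFinite μ₂] :
    MixedLebesgue.IsBanachSpace (MixedLebesgue.sumSpace μ₁ μ₂) ∧
    (∀ (f : X₁ × X₂ → ℂ) (hf : Measurable f),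
      AEEqFun.mk f hf.aestronglyMeasurable ∈ MixedLebesgue.sumSpace μ₁ μ₂ ↔
        ∀ g : MixedLebesgue.interSpace μ₁ μ₂,
          Integrable (fun x => f x * g.1 x) (μ₁.prod μ₂)) ∧
    (∀ f : MixedLebesgue.sumSpace μ₁ μ₂,
      (ENNReal.ofReal (1 / 16 * ‖f‖) ≤
          (⨆ (g : MixedLebesgue.interSpace μ₁ μ₂) (_ : ‖g‖ ≤ 1),
            ∫⁻ x, ‖f.1 x * g.1 x‖ₑ ∂(μ₁.prod μ₂))) ∧
      ((⨆ (g : MixedLebesgue.interSpace μ₁ μ₂) (_ : ‖g‖ ≤ 1),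
            ∫⁻ x, ‖f.1 x * g.1 x‖ₑ ∂(μ₁.prod μ₂)) ≤
          ENNReal.ofReal (16 * ‖f‖))) := by
  refine ⟨MixedLebesgue.isBanachSpace_sumSpace, fun f hf => ?_, fun f => ?_⟩
  · have hmem : AEEqFun.mk f hf.aestronglyMeasurable ∈ MixedLebesgue.sumSpace μ₁ μ₂ ↔
        MixedLebesgue.sumENorm μ₁ μ₂ f < ∞ := by
      rw [← MixedLebesgue.sumENorm_congr (AEEqFun.coeFn_mk f hf.aestronglyMeasurable)]
      rfl
    rw [hmem]
    constructor
    · exact fun h g => ⟨(hf.mul g.1.measurable).aestronglyMeasurable,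
        MixedLebesgue.lintegral_mul_interSpace_lt_top hf h g⟩
    · intro h
      rw [lt_top_iff_ne_top]
      intro htop
      obtain ⟨g, hg⟩ := MixedLebesgue.exists_lintegral_mul_eq_top hf htop
      exact (h g).2.ne hg
  · have hf0 : 0 ≤ ‖f‖ := MixedLebesgue.normedSpaceCore_sumSpace.norm_nonneg f
    have hnorm : ENNReal.ofReal ‖f‖ = MixedLebesgue.sumENorm μ₁ μ₂ f.1 :=
      ENNReal.ofReal_toReal (ne_of_lt f.2)
    constructor
    · refine le_trans ?_ (MixedLebesgue.sumENorm_le_iSup_lintegral_mul f.1.measurable)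
      rw [← hnorm]
      exact ENNReal.ofReal_le_ofReal (by linarith)
    · refine (MixedLebesgue.iSup_lintegral_mul_le_sumENorm f.1.measurable).trans ?_
      rw [← hnorm]
      exact ENNReal.ofReal_le_ofReal (by linarith)
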